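/- **Terms.** Terms, taken up to renaming of bound variables, are $M,N ::= x \mid \lambda x M \mid MN \mid M[N/x]$, where $M[N/x]$ is an explicit substitution binding $x$ in $M$, and $M\{N/x\}$ denotes capture-avoiding substitution. Values $V$ are variables and abstractions. List contexts are $L=\square[M_1/x_1]\dots[M_k/x_k]$ ($k\ge 0$); bound variables are renamed so that no rule below captures variables. The reductions are closed under all contexts: - dCBN: $L\langle\lambda x M\rangle N\to_n L\langle M[N/x]\rangle$ and $M[N/x]\to_n M\{N/x\}$; - dCBV: $L\langle\lambda x M\rangle N\to_v L\langle M[N/x]\rangle$ and $M[L\langle V\rangle/x]\to_v L\langle M\{V/x\}\rangle$. **Böhm trees.** Partial terms may also contain the constant $\bot$. For a partial term $A$ and a term $N$, $A\sqsubseteq N$ means that $A$ is obtained from $N$ by replacing subterms with $\bot$. The dCBN approximants are $A_n ::= \bot\mid N_\lambda\mid\lambda x A_n$ with $N_\lambda ::= x\mid N_\lambda A_n$. The dCBV approximants are $A_v ::= \bot\mid A_\lambda\mid\lambda x A_v\mid A_v[A_{x\lambda}/x]$ with $A_\lambda ::= x\mid A_\lambda A_v\mid A_\lambda[A_{x\lambda}/x]$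 and $A_{x\lambda} ::= A_\lambda A_v\mid A_{x\lambda}[A_{x\lambda}/x]$. For $\circ\in\{n,v\}$, the Böhm tree $BT_\circ(M)$ is the set of all approximants $A_\circ$ such that $A_\circ\sqsubseteq N$ for some $N$ with $M\to_\circ^* N$. **Resource terms.** These are $m,n ::= x\mid\lambda x m\mid mn\mid m[n/x]\mid \mathrm{der}\,m\mid[m_1,\dots,m_k]$, where $[m_1,\dots,m_k]$ ($k\ge0$) is a finite multiset. With list contexts $l=\square[n_1/x_1]\dots[n_j/x_j]$, and $d_x(m)$ the number of free occurrences $x_1,\dots,x_{d_x(m)}$ of $x$ in $m$, the reduction rules are - $l\langle\lambda x m\rangle n\to l\langle m[n/x]\rangle$; - $m[l\langle[n_1,\dots,n_k]\rangle/x]\to l\langle m\{n_{\sigma(1)}/x_1,\dots,n_{\sigma(k)}/x_k\}\rangle$ for every permutation $\sigma$ if $k=d_x(m)$, and $\to\emptyset$ if $k\ne d_x(m)$; - $\mathrm{der}(l\langle[m]\rangle)\to l\langle m\rangle$, and $\mathrm{der}(l\langle[m_1,\dots,m_k]\rangle)\to\emptyset$ if $k\neq1$; closed under all contexts, a term with a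 subterm reducing to $\emptyset$ reducing itself to $\emptyset$. A resource term is normal if it has no reduction at all, including to $\emptyset$. For a set $T$ of resource terms, $\mathrm{nf}(T)$ is the set of the normal resource terms $p$ such that $m\to^*p$ for some $m\in T$. **Taylor expansions.** Let $\mathcal T_n(M)=\{m\mid m\lhd_n M\}$ and $\mathcal T_v(M)=\{m\mid m\lhd_v M\}$, for $M$ a term or a partial term, where $\lhd_n$ and $\lhd_v$ are given inductively as follows (in particular $\bot$ has no approximation). - $x\lhd_n x$; $\lambda x m\lhd_n\lambda x M$ if $m\lhd_n M$; $m[n_1,\dots,n_k]\lhd_n MN$ and $m[[n_1,\dots,n_k]/x]\lhd_n M[N/x]$ if $m\lhd_n M$ and $n_i\lhd_n N$ for all $i\le k$ ($k\ge 0$). - $[x,\dots,x]_k\lhd_v x$ for all $k\ge0$; $[\lambda x m_1,\dots,\lambda x m_k]\lhd_v\lambda x M$ if $m_i\lhd_v M$ for all $i\le k$ ($k\ge 0$); $m[n/x]\lhd_v M[N/x]$ if $m\lhd_v M$ and $n\lhd_v N$; $(\mathrm{der}\,m)\,n\lhd_v MN$ if $m\lhd_v M$, $n\lhd_v N$ and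 $M$ is not of the form $L\langle V\rangle$; $l\langle m\rangle n\lhd_v MN$ if $M$ is of the form $L\langle V\rangle$, $l\langle[m]\rangle\lhd_v M$ and $n\lhd_v N$. The Taylor expansion of a Böhm tree is $\mathcal T_\circ(BT_\circ(M))=\bigcup_{A\in BT_\circ(M)}\mathcal T_\circ(A)$. **Theorem.** 1. For every dCBV term $M$, $\mathcal T_v(BT_v(M))=\mathrm{nf}(\mathcal T_v(M))$. 2. For every dCBN term $M$, $\mathcal T_n(BT_n(M))=\mathrm{nf}(\mathcal T_n(M))$. -/

import Mathlib

namespace DistantCalc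

/-! ### Terms of the distant calculi, and partial terms

Terms are taken modulo renaming of bound variables, by means of de Bruijn indices: `lam M` and
`es M N` (the explicit substitution `M[N/x]`) bind the index `0` of `M`. -/

/-- Terms `x | λx M | M N | M[N/x]`, with additional constants taken from `B`. -/
inductive Tm (B : Type) : Type
  | bot : B → Tm B
  | var : ℕ → Tm B
  | lam : Tm B → Tm B
  | app : Tm B → Tm B → Tm B
  | es : Tm B → Tm B → Tm B

/-- The common syntax of dCBN and dCBV: there is no additional constant. -/
abbrev Term : Type := Tm Empty

/-- Terms with one additional constant, written `⊥`. -/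
abbrev PTerm : Type := Tm Unit

/-- The constant `⊥`. -/
abbrev PTerm.bottom : PTerm := Tm.bot ()

/-- The action of a renaming below a binder. -/
def liftRen (f : ℕ → ℕ) : ℕ → ℕ
  | 0 => 0
  | x + 1 => f x + 1

namespace Tm

variable {B : Type}

/-- Renaming of the free variables. -/
def rename : (ℕ → ℕ) → Tm B → Tm B
  | _, bot b => bot b
  | f, var x => var (f x)
  | f, lam M => lam (rename (liftRen f) M)
  | f, app M N => app (rename f M) (rename f N)
  | f, es M N => es (rename (liftRen f) M) (rename f N)

/-- The action of a parallel substitution below a binder. -/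
def liftSub (σ : ℕ → Tm B) : ℕ → Tm B
  | 0 => var 0
  | x + 1 => rename Nat.succ (σ x)

/-- Capture-avoiding parallel substitution. -/
def subst : (ℕ → Tm B) → Tm B → Tm B
  | _, bot b => bot b
  | σ, var x => σ x
  | σ, lam M => lam (subst (liftSub σ) M)
  | σ, app M N => app (subst σ M) (subst σ N)
  | σ, es M N => es (subst (liftSub σ) M) (subst σ N)

/-- `inst k N M` is `M{N/x}`, where `x` is the index `0` of `M`, and the result is placed below
`k` further binders (in whose scope `N` already lives). -/
def inst (k : ℕ) (N : Tm B) (M : Tm B) : Tm B :=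
  subst (fun x => match x with
    | 0 => N
    | y + 1 => var (y + k)) M

/-- `plug [M₁, …, Mₖ] M` is `L⟨M⟩` for the list context `L = □[M₁/x₁]…[Mₖ/xₖ]`; the term `M`
lies below `k` binders. -/
def plug (L : List (Tm B)) (M : Tm B) : Tm B := L.foldl es M

/-- Values: variables and abstractions. -/
inductive IsValue : Tm B → Prop
  | var (x : ℕ) : IsValue (var x)
  | lam (M : Tm B) : IsValue (lam M)

/-- Terms of the form `L⟨V⟩` with `V` a value. -/
def IsAnswer (M : Tm B) : Prop := ∃ (L : List (Tm B)) (V : Tm B), IsValue V ∧ M = plug L V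

end Tm

/-! ### Reductions of dCBN and dCBV (closed under all contexts) -/

/-- One step of dCBN reduction. -/
inductive StepN : Term → Term → Prop
  | beta (L : List Term) (M N : Term) :
      StepN (.app (Tm.plug L (.lam M)) N) (Tm.plug L (.es M (N.rename (· + L.length))))
  | subst (M N : Term) : StepN (.es M N) (Tm.inst 0 N M)
  | lam {M M' : Term} : StepN M M' → StepN (.lam M) (.lam M')
  | appL {M M' : Term} (N : Term) : StepN M M' → StepN (.app M N) (.app M' N)
  | appR (M : Term) {N N' : Term} : StepN N N' → StepN (.app M N) (.app M N')
  | esL {M M' : Term} (N : Term) : StepN M M' → StepN (.es M N) (.es M' N)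
  | esR (M : Term) {N N' : Term} : StepN N N' → StepN (.es M N) (.es M N')

/-- One step of dCBV reduction. -/
inductive StepV : Term → Term → Prop
  | beta (L : List Term) (M N : Term) :
      StepV (.app (Tm.plug L (.lam M)) N) (Tm.plug L (.es M (N.rename (· + L.length))))
  | subst (L : List Term) (M V : Term) : V.IsValue →
      StepV (.es M (Tm.plug L V)) (Tm.plug L (Tm.inst L.length V M))
  | lam {M M' : Term} : StepV M M' → StepV (.lam M) (.lam M')
  | appL {M M' : Term} (N : Term) : StepV M M' → StepV (.app M N) (.app M' N)
  | appR (M : Term) {N N' : Term} : StepV N N' → StepV (.app M N) (.app M N')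
  | esL {M M' : Term} (N : Term) : StepV M M' → StepV (.es M N) (.es M' N)
  | esR (M : Term) {N N' : Term} : StepV N N' → StepV (.es M N) (.es M N')

/-! ### Böhm approximants and Böhm trees -/

/-- `A ⊑ M`: the partial term `A` is obtained from `M` by replacing subterms with `⊥`. -/
inductive Le : PTerm → Term → Prop
  | bot (M : Term) : Le PTerm.bottom M
  | var (x : ℕ) : Le (.var x) (.var x)
  | lam {A : PTerm} {M : Term} : Le A M → Le (.lam A) (.lam M)
  | app {A A' : PTerm} {M M' : Term} : Le A M → Le A' M' → Le (.app A A') (.app M M')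
  | es {A A' : PTerm} {M M' : Term} : Le A M → Le A' M' → Le (.es A A') (.es M M')

mutual
/-- The dCBN approximants `Aₙ ::= ⊥ | N_λ | λx Aₙ`. -/
inductive ApproximantN : PTerm → Prop
  | bot : ApproximantN PTerm.bottom
  | neutral {A : PTerm} : NeutralN A → ApproximantN A
  | lam {A : PTerm} : ApproximantN A → ApproximantN (.lam A)
/-- `N_λ ::= x | N_λ Aₙ`. -/
inductive NeutralN : PTerm → Prop
  | var (x : ℕ) : NeutralN (.var x)
  | app {A A' : PTerm} : NeutralN A → ApproximantN A' → NeutralN (.app A A')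
end

mutual
/-- The dCBV approximants `A_v ::= ⊥ | A_λ | λx A_v | A_v[A_xλ/x]`. -/
inductive ApproximantV : PTerm → Prop
  | bot : ApproximantV PTerm.bottom
  | nonLam {A : PTerm} : NonLamV A → ApproximantV A
  | lam {A : PTerm} : ApproximantV A → ApproximantV (.lam A)
  | es {A A' : PTerm} : ApproximantV A → NonValueV A' → ApproximantV (.es A A')
/-- `A_λ ::= x | A_λ A_v | A_λ[A_xλ/x]`. -/
inductive NonLamV : PTerm → Prop
  | var (x : ℕ) : NonLamV (.var x)
  | app {A A' : PTerm} : NonLamV A → ApproximantV A' → NonLamV (.app A A')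
  | es {A A' : PTerm} : NonLamV A → NonValueV A' → NonLamV (.es A A')
/-- `A_xλ ::= A_λ A_v | A_xλ[A_xλ/x]`. -/
inductive NonValueV : PTerm → Prop
  | app {A A' : PTerm} : NonLamV A → ApproximantV A' → NonValueV (.app A A')
  | es {A A' : PTerm} : NonValueV A → NonValueV A' → NonValueV (.es A A')
end

/-- The Böhm tree of a dCBN term, as the set of its finite approximants. -/
def bohmN (M : Term) : Set PTerm :=
  {A | ApproximantN A ∧ ∃ N : Term, Relation.ReflTransGen StepN M N ∧ Le A N}

/-- The Böhm tree of a dCBV term, as the set of its finite approximants. -/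
def bohmV (M : Term) : Set PTerm :=
  {A | ApproximantV A ∧ ∃ N : Term, Relation.ReflTransGen StepV M N ∧ Le A N}

/-! ### Resource terms

Resource terms are `x | λx m | m n | m[n/x] | der m | [m₁, …, mₖ]`, where `[m₁, …, mₖ]` is a finite
multiset. They are obtained from terms in which the bags are lists, by identifying
bags up to permutation, hereditarily. -/

/-- Resource terms with lists in the place of multisets. -/
inductive PreRes : Type
  | var : ℕ → PreRes
  | lam : PreRes → PreRes
  | app : PreRes → PreRes → PreRes
  | es : PreRes → PreRes → PreRes
  | der : PreRes → PreRes
  | bag : List PreRes → PreRes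

namespace PreRes

/-- The congruence generated by the permutations of bags. -/
inductive Equiv : PreRes → PreRes → Prop
  | refl (m : PreRes) : Equiv m m
  | symm {m n : PreRes} : Equiv m n → Equiv n m
  | trans {m n p : PreRes} : Equiv m n → Equiv n p → Equiv m p
  | lam {m m' : PreRes} : Equiv m m' → Equiv (lam m) (lam m')
  | app {m m' n n' : PreRes} : Equiv m m' → Equiv n n' → Equiv (app m n) (app m' n')
  | es {m m' n n' : PreRes} : Equiv m m' → Equiv n n' → Equiv (es m n) (es m' n')
  | der {m m' : PreRes} : Equiv m m' → Equiv (der m) (der m')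
  | bagPerm {l l' : List PreRes} : l.Perm l' → Equiv (bag l) (bag l')
  | bagHead {m m' : PreRes} (l : List PreRes) :
      Equiv m m' → Equiv (bag (m :: l)) (bag (m' :: l))

instance setoid : Setoid PreRes := ⟨Equiv, Equiv.refl, Equiv.symm, Equiv.trans⟩

mutual
/-- Renaming of the free variables. -/
def rename : (ℕ → ℕ) → PreRes → PreRes
  | f, var x => var (f x)
  | f, lam m => lam (rename (liftRen f) m)
  | f, app m n => app (rename f m) (rename f n)
  | f, es m n => es (rename (liftRen f) m) (rename f n)
  | f, der m => der (rename f m)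
  | f, bag l => bag (renameList f l)
/-- Renaming of the free variables of the elements of a list. -/
def renameList : (ℕ → ℕ) → List PreRes → List PreRes
  | _, [] => []
  | f, m :: l => rename f m :: renameList f l
end

mutual
/-- The number of free occurrences of the variable `x`. -/
def degree : ℕ → PreRes → ℕ
  | x, var y => if x = y then 1 else 0
  | x, lam m => degree (x + 1) m
  | x, app m n => degree x m + degree x n
  | x, es m n => degree (x + 1) m + degree x n
  | x, der m => degree x m
  | x, bag l => degreeList x l
/-- The number of free occurrences of the variable `x` in a list. -/
def degreeList : ℕ → List PreRes → ℕ
  | _, [] => 0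
  | x, m :: l => degree x m + degreeList x l
end

theorem renameList_eq (f : ℕ → ℕ) (l : List PreRes) : renameList f l = l.map (rename f) := by
  induction l with
  | nil => simp [renameList]
  | cons m l ih => simp [renameList, ih]

theorem degreeList_eq (x : ℕ) (l : List PreRes) :
    degreeList x l = (l.map (degree x)).sum := by
  induction l with
  | nil => simp [degreeList]
  | cons m l ih => simp [degreeList, ih]

theorem Equiv.rename {m n : PreRes} (h : Equiv m n) :
    ∀ f : ℕ → ℕ, Equiv (m.rename f) (n.rename f) := by
  induction h with
  | refl m => exact fun f => .refl _
  | symm _ ih => exact fun f => (ih f).symm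
  | trans _ _ ih ih' => exact fun f => (ih f).trans (ih' f)
  | lam _ ih => intro f; simp only [PreRes.rename]; exact .lam (ih _)
  | app _ _ ih ih' => intro f; simp only [PreRes.rename]; exact .app (ih _) (ih' _)
  | es _ _ ih ih' => intro f; simp only [PreRes.rename]; exact .es (ih _) (ih' _)
  | der _ ih => intro f; simp only [PreRes.rename]; exact .der (ih _)
  | bagPerm h =>
    intro f; simp only [PreRes.rename, renameList_eq]; exact .bagPerm (h.map _)
  | bagHead l _ ih => intro f; simp only [PreRes.rename, renameList]; exact .bagHead _ (ih _)

theorem Equiv.degree {m n : PreRes} (h : Equiv m n) : ∀ x : ℕ, m.degree x = n.degree x := by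
  induction h with
  | refl m => exact fun x => rfl
  | symm _ ih => exact fun x => (ih x).symm
  | trans _ _ ih ih' => exact fun x => (ih x).trans (ih' x)
  | lam _ ih => intro x; simp only [PreRes.degree, ih]
  | app _ _ ih ih' => intro x; simp only [PreRes.degree, ih, ih']
  | es _ _ ih ih' => intro x; simp only [PreRes.degree, ih, ih']
  | der _ ih => intro x; simp only [PreRes.degree, ih]
  | bagPerm h =>
    intro x; simp only [PreRes.degree, degreeList_eq]; exact (h.map _).sum_eq
  | bagHead l _ ih => intro x; simp only [PreRes.degree, degreeList, ih]

end PreRes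

/-- Resource terms. -/
def Res : Type := Quotient PreRes.setoid

namespace Res

/-- The resource term represented by `m`. -/
def mk (m : PreRes) : Res := Quotient.mk _ m

/-- A chosen representative of a resource term. -/
noncomputable def out (m : Res) : PreRes := Quotient.out m

/-- The variable `x`. -/
def var (x : ℕ) : Res := mk (.var x)

/-- Abstraction, binding the index `0`. -/
def lam : Res → Res := Quotient.map PreRes.lam fun _ _ h => PreRes.Equiv.lam h

/-- Application. -/
def app : Res → Res → Res :=
  Quotient.map₂ PreRes.app fun _ _ h _ _ h' => PreRes.Equiv.app h h'

/-- Explicit substitution `m[n/x]`, binding the index `0` of `m`. -/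
def es : Res → Res → Res :=
  Quotient.map₂ PreRes.es fun _ _ h _ _ h' => PreRes.Equiv.es h h'

/-- Dereliction. -/
def der : Res → Res := Quotient.map PreRes.der fun _ _ h => PreRes.Equiv.der h

/-- The bag `[m₁, …, mₖ]`. -/
noncomputable def bag (s : Multiset Res) : Res :=
  Quotient.liftOn s (fun l : List Res => mk (.bag (l.map out)))
    fun _ _ h => Quotient.sound (PreRes.Equiv.bagPerm (List.Perm.map _ h))

/-- Renaming of the free variables. -/
def rename (f : ℕ → ℕ) : Res → Res :=
  Quotient.map (PreRes.rename f) fun _ _ h => PreRes.Equiv.rename h f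

/-- The number `d_x(m)` of free occurrences of the variable `x` in `m`. -/
def degree (x : ℕ) : Res → ℕ :=
  Quotient.lift (PreRes.degree x) fun _ _ h => PreRes.Equiv.degree h x

/-- `plug [n₁, …, nₖ] m` is `l⟨m⟩` for the list context `l = □[n₁/x₁]…[nₖ/xₖ]`. -/
def plug (l : List Res) (m : Res) : Res := l.foldl es m

end Res

/-- `LinSubst k d s m r`: the term `r` is obtained from `m` by replacing the occurrences of the
variable of index `d` by the elements of the multiset `s`, each element being used for exactly one
occurrence. The variables of index `< d` are those bound above the current subterm (to start with,
`d = 0`); the variables of index `> d` are adapted to the removal of the variable `d` and to the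
addition of `k` binders, in whose scope the elements of `s` already live. -/
inductive LinSubst (k : ℕ) : ℕ → Multiset Res → Res → Res → Prop
  | hit (d : ℕ) (n : Res) : LinSubst k d {n} (.var d) n
  | lt {d x : ℕ} : x < d → LinSubst k d 0 (.var x) (.var x)
  | gt {d x : ℕ} : d ≤ x → LinSubst k d 0 (.var (x + 1)) (.var (x + k))
  | lam {d : ℕ} {s : Multiset Res} {m m' : Res} :
      LinSubst k (d + 1) (s.map (Res.rename Nat.succ)) m m' → LinSubst k d s m.lam m'.lam
  | app {d : ℕ} {s t : Multiset Res} {m m' n n' : Res} :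
      LinSubst k d s m m' → LinSubst k d t n n' → LinSubst k d (s + t) (m.app n) (m'.app n')
  | es {d : ℕ} {s t : Multiset Res} {m m' n n' : Res} :
      LinSubst k (d + 1) (s.map (Res.rename Nat.succ)) m m' → LinSubst k d t n n' →
      LinSubst k d (s + t) (m.es n) (m'.es n')
  | der {d : ℕ} {s : Multiset Res} {m m' : Res} :
      LinSubst k d s m m' → LinSubst k d s m.der m'.der
  | bagNil (d : ℕ) : LinSubst k d 0 (.bag 0) (.bag 0)
  | bagCons {d : ℕ} {s t : Multiset Res} {m m' : Res} {u u' : Multiset Res} :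
      LinSubst k d s m m' → LinSubst k d t (.bag u) (.bag u') →
      LinSubst k d (s + t) (.bag (m ::ₘ u)) (.bag (m' ::ₘ u'))

/-- One step of resource reduction, closed under all contexts. `StepR m (some n)` is `m → n`, and
`StepR m none` is `m → ∅`. -/
inductive StepR : Res → Option Res → Prop
  | beta (l : List Res) (m n : Res) :
      StepR (.app (.plug l (.lam m)) n) (some (.plug l (.es m (n.rename (· + l.length)))))
  | subst (l : List Res) (s : Multiset Res) (m r : Res) : LinSubst l.length 0 s m r →
      StepR (.es m (.plug l (.bag s))) (some (.plug l r))
  | substEmpty (l : List Res) (s : Multiset Res) (m : Res) : m.degree 0 ≠ s.card →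
      StepR (.es m (.plug l (.bag s))) none
  | derBag (l : List Res) (m : Res) : StepR (.der (.plug l (.bag {m}))) (some (.plug l m))
  | derEmpty (l : List Res) (s : Multiset Res) : s.card ≠ 1 →
      StepR (.der (.plug l (.bag s))) none
  | lam {m : Res} {o : Option Res} : StepR m o → StepR m.lam (o.map fun m' => m'.lam)
  | appL {m : Res} {o : Option Res} (n : Res) :
      StepR m o → StepR (m.app n) (o.map fun m' => m'.app n)
  | appR (m : Res) {n : Res} {o : Option Res} :
      StepR n o → StepR (m.app n) (o.map fun n' => m.app n')
  | esL {m : Res} {o : Option Res} (n : Res) :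
      StepR m o → StepR (m.es n) (o.map fun m' => m'.es n)
  | esR (m : Res) {n : Res} {o : Option Res} :
      StepR n o → StepR (m.es n) (o.map fun n' => m.es n')
  | der {m : Res} {o : Option Res} : StepR m o → StepR m.der (o.map fun m' => m'.der)
  | bag {m : Res} {o : Option Res} (s : Multiset Res) :
      StepR m o → StepR (.bag (m ::ₘ s)) (o.map fun m' => .bag (m' ::ₘ s))

/-- Resource terms without any reduction, not even to `∅`. -/
def Res.IsNormal (p : Res) : Prop := ∀ o : Option Res, ¬ StepR p o

/-- The set of the normal forms of the elements of `T`. -/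
def nf (T : Set Res) : Set Res :=
  {p | p.IsNormal ∧ ∃ m ∈ T, Relation.ReflTransGen (fun a b => StepR a (some b)) m p}

/-! ### Taylor expansions -/

/-- Resource approximation for dCBN; the constants have no approximation. -/
inductive ApproxN {B : Type} : Res → Tm B → Prop
  | var (x : ℕ) : ApproxN (.var x) (.var x)
  | lam {m : Res} {M : Tm B} : ApproxN m M → ApproxN (.lam m) (.lam M)
  | app {m : Res} {s : Multiset Res} {M N : Tm B} :
      ApproxN m M → (∀ n ∈ s, ApproxN n N) → ApproxN (.app m (.bag s)) (.app M N)
  | es {m : Res} {s : Multiset Res} {M N : Tm B} :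
      ApproxN m M → (∀ n ∈ s, ApproxN n N) → ApproxN (.es m (.bag s)) (.es M N)

/-- Resource approximation for dCBV; the constants have no approximation. -/
inductive ApproxV {B : Type} : Res → Tm B → Prop
  | var (k x : ℕ) : ApproxV (.bag (Multiset.replicate k (.var x))) (.var x)
  | lam {s : Multiset Res} {M : Tm B} :
      (∀ m ∈ s, ApproxV m M) → ApproxV (.bag (s.map Res.lam)) (.lam M)
  | app {m n : Res} {M N : Tm B} : ¬ M.IsAnswer →
      ApproxV m M → ApproxV n N → ApproxV (.app (.der m) n) (.app M N)
  | appAnswer {l : List Res} {m n : Res} {M N : Tm B} : M.IsAnswer →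
      ApproxV (.plug l (.bag {m})) M → ApproxV n N → ApproxV (.app (.plug l m) n) (.app M N)
  | es {m n : Res} {M N : Tm B} : ApproxV m M → ApproxV n N → ApproxV (.es m n) (.es M N)

/-- The Taylor expansion of a dCBN (possibly partial) term. -/
def taylorN {B : Type} (M : Tm B) : Set Res := {m | ApproxN m M}

/-- The Taylor expansion of a dCBV (possibly partial) term. -/
def taylorV {B : Type} (M : Tm B) : Set Res := {m | ApproxV m M}

/-- The Taylor expansion of a dCBN Böhm tree. -/
def taylorTreeN (T : Set PTerm) : Set Res := ⋃ A ∈ T, taylorN A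

/-- The Taylor expansion of a dCBV Böhm tree. -/
def taylorTreeV (T : Set PTerm) : Set Res := ⋃ A ∈ T, taylorV A

end DistantCalc

namespace DistantCalc

/-! ### Substitution -/

-- Both calculi are treated by the same argument, one inclusion at a time.
--
-- From the tree to the normal forms: let `p` approximate an approximant `A ⊑ N`, where `M` reduces
-- to `N`. Approximants contain no visible redex, so `p` is normal (`ApproximantV.approx_isNormal`,
-- `ApproximantN.approx_isNormal`). Moreover `p` approximates `N`, and approximations can be pulled
-- back along reduction (`ApproxSpine.of_stepsV`, `ApproxN.of_stepsN`): an approximation of a reduct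
-- is itself a resource reduct of an approximation of the source. The core of this is that every
-- approximation of an instance of `M` is a linear substitution applied to an approximation of `M`.
--
-- From the normal forms to the tree: let `m` approximate `M` and reduce to a normal `p`. The
-- intermediate resource terms need not approximate any reduct of `M`, because a step acts on one
-- element of a bag and leaves the others behind. The relations `EvApproxV` and `EvApproxN` are
-- therefore weakened so that the approximated term may be reduced at every node, independently for
-- each element of a bag. With `M` fixed, they are invariant under resource reduction
-- (`EvApproxV.stepR`, `EvApproxN.stepR`). Once `p` is normal, the independent reductions can be
-- synchronised. Two reducts have a common reduct by confluence (`Steps.confluent`), and a normal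
-- approximation survives further reduction of the approximated term, since any redex contracted
-- there is invisible to it (`ApproxSpine.step`, `ApproxN.step`). Hence `p` approximates a single
-- reduct `N` of `M` in the strict sense (`realized`). Replacing by `⊥` the subterms of `N` that no
-- normal approximation can see yields an approximant that `p` still approximates
-- (`exists_approximantV`, `exists_approximantN`).
--
-- Confluence holds because parallel reduction, allowed to fire redexes created below the root, has
-- a maximal development of every term (`Par.exists_triangle`). In dCBV the application rule depends
-- on whether the function is an answer `L⟨V⟩`. This is handled by splitting approximation into two
-- mutually dependent judgements (`ApproxSpine`), and by the fact that the resource term itself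
-- reveals whether the approximated term is an answer (`ApproxSpine.bagSpine_iff`).

theorem liftRen_comp (g f : ℕ → ℕ) : liftRen (g ∘ f) = liftRen g ∘ liftRen f := by
  funext x; cases x <;> rfl

theorem liftRen_id : liftRen id = id := by
  funext x; cases x <;> rfl

namespace Tm

variable {B : Type}

theorem rename_rename (M : Tm B) : ∀ f g : ℕ → ℕ, rename g (rename f M) = rename (g ∘ f) M := by
  induction M <;> intro f g <;> simp_all [rename, liftRen_comp]

theorem rename_id (M : Tm B) : rename id M = M := by
  induction M <;> simp_all [rename, liftRen_id]

theorem liftSub_comp_liftRen (σ : ℕ → Tm B) (f : ℕ → ℕ) :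
    liftSub σ ∘ liftRen f = liftSub (σ ∘ f) := by
  funext x; cases x <;> rfl

theorem subst_rename (M : Tm B) :
    ∀ (f : ℕ → ℕ) (σ : ℕ → Tm B), subst σ (rename f M) = subst (σ ∘ f) M := by
  induction M <;> intro f σ <;> simp_all [rename, subst, liftSub_comp_liftRen]

theorem rename_comp_liftSub (f : ℕ → ℕ) (σ : ℕ → Tm B) :
    rename (liftRen f) ∘ liftSub σ = liftSub (rename f ∘ σ) := by
  funext x; cases x
  · rfl
  · simp only [Function.comp, liftSub, rename_rename]; rfl

theorem rename_subst (M : Tm B) :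
    ∀ (σ : ℕ → Tm B) (f : ℕ → ℕ), rename f (subst σ M) = subst (rename f ∘ σ) M := by
  induction M <;> intro f σ <;> simp_all [rename, subst, rename_comp_liftSub]

theorem subst_comp_liftSub (τ σ : ℕ → Tm B) :
    subst (liftSub τ) ∘ liftSub σ = liftSub (subst τ ∘ σ) := by
  funext x; cases x
  · rfl
  · simp only [Function.comp, liftSub, rename_subst, subst_rename]; rfl

theorem subst_subst (M : Tm B) :
    ∀ σ τ : ℕ → Tm B, subst τ (subst σ M) = subst (subst τ ∘ σ) M := by
  induction M <;> intro f σ <;> simp_all [subst, subst_comp_liftSub]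

theorem liftSub_var : liftSub (var : ℕ → Tm B) = var := by
  funext x; cases x <;> rfl

theorem subst_var (M : Tm B) : subst var M = M := by
  induction M <;> simp_all [subst, liftSub_var]

/-- The substitution of `N` for the variable `0`. -/
def single (N : Tm B) : ℕ → Tm B
  | 0 => N
  | y + 1 => var y

theorem inst_zero (N M : Tm B) : inst 0 N M = subst (single N) M := by
  unfold inst; congr 1

/-- The shift past `k` binders can be performed on `M` beforehand, so the commutation laws of
substitution are needed for `k = 0` only. -/
theorem inst_eq (k : ℕ) (N M : Tm B) : inst k N M = inst 0 N (rename (liftRen (· + k)) M) := by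
  rw [inst_zero, subst_rename]; unfold inst; congr 1; funext x; cases x <;> rfl

theorem subst_inst (σ : ℕ → Tm B) (N M : Tm B) :
    subst σ (inst 0 N M) = inst 0 (subst σ N) (subst (liftSub σ) M) := by
  simp only [inst_zero, subst_subst]
  congr 1; funext x; cases x
  · rfl
  · simp only [Function.comp, liftSub, single, subst, subst_rename]
    exact (subst_var _).symm

theorem rename_inst (f : ℕ → ℕ) (N M : Tm B) :
    rename f (inst 0 N M) = inst 0 (rename f N) (rename (liftRen f) M) := by
  simp only [inst_zero, rename_subst, subst_rename]
  congr 1; funext x; cases x <;> rfl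

theorem inst_rename_succ (N M : Tm B) : inst 0 N (rename Nat.succ M) = M := by
  rw [inst_zero, subst_rename]; exact subst_var M

theorem subst_rename_succ (σ : ℕ → Tm B) (M : Tm B) :
    subst (liftSub σ) (rename Nat.succ M) = rename Nat.succ (subst σ M) := by
  rw [subst_rename, rename_subst]; rfl

theorem rename_rename_succ (f : ℕ → ℕ) (M : Tm B) :
    rename (liftRen f) (rename Nat.succ M) = rename Nat.succ (rename f M) := by
  rw [rename_rename, rename_rename]; rfl

theorem subst_single_liftRen_succ (M V : Tm B) :
    subst (liftSub (single V)) (rename (liftRen Nat.succ) M) = M := by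
  rw [subst_rename, liftSub_comp_liftRen]
  have : single V ∘ Nat.succ = var := rfl
  rw [this, liftSub_var, subst_var]

theorem plug_append (L : List (Tm B)) (M N : Tm B) : plug (L ++ [N]) M = es (plug L M) N := by
  simp [plug]

theorem IsValue.rename {V : Tm B} (h : IsValue V) (f : ℕ → ℕ) : IsValue (V.rename f) := by
  cases h <;> constructor

theorem IsValue.subst {V : Tm B} (h : IsValue V) {σ : ℕ → Tm B} (hσ : ∀ x, IsValue (σ x)) :
    IsValue (V.subst σ) := by
  cases h
  · exact hσ _
  · constructor

end Tm

/-! ### Root steps without list contexts -/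

open Tm

variable {B : Type}

/-- `Beta Q N R`: the term `Q` is `L⟨λx P⟩`, and `R` is `L⟨P[N/x]⟩`. -/
inductive Beta : Tm B → Tm B → Tm B → Prop
  | lam (P N : Tm B) : Beta (.lam P) N (.es P N)
  | es {Q N R : Tm B} (S : Tm B) : Beta Q (N.rename Nat.succ) R → Beta (.es Q S) N (.es R S)

/-- `Sub v M N R`: the term `M[N/x]` reduces to `R` at the root, in dCBV if `v` holds and in dCBN
otherwise. -/
inductive Sub (v : Bool) : Tm B → Tm B → Tm B → Prop
  | inst {V : Tm B} (M : Tm B) : (v = true → V.IsValue) → Sub v M V (Tm.inst 0 V M)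
  | es {M Q R : Tm B} (S : Tm B) : v = true → Sub v (M.rename (liftRen Nat.succ)) Q R →
      Sub v M (.es Q S) (.es R S)

theorem beta_plug (L : List (Tm B)) (P : Tm B) :
    ∀ N, Beta (plug L (.lam P)) N (plug L (.es P (N.rename (· + L.length)))) := by
  -- `plug` is a left fold: the outermost explicit substitution is the last element, so the
  -- induction runs from the end of the list. The shift by the length of the list becomes one shift
  -- for each entry crossed.
  induction L using List.reverseRecOn with
  | nil =>
    intro N
    have : (N.rename (· + ([] : List (Tm B)).length)) = N := rename_id N
    rw [this]; exact .lam P N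
  | append_singleton L S ih =>
    intro N
    rw [plug_append, plug_append]
    convert Beta.es S (ih _) using 4
    rw [rename_rename]; congr 1; funext x; simp only [Function.comp, List.length_append, List.length_singleton]; omega

theorem Beta.exists_plug {Q N R : Tm B} (h : Beta Q N R) :
    ∃ L P, Q = plug L (.lam P) ∧ R = plug L (.es P (N.rename (· + L.length))) := by
  induction h with
  | lam P N => exact ⟨[], P, rfl, congrArg (Tm.es P) (rename_id N).symm⟩
  | es S h ih =>
    obtain ⟨L, P, rfl, rfl⟩ := ih
    refine ⟨L ++ [S], P, (plug_append _ _ _).symm, ?_⟩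
    rw [plug_append, rename_rename]
    congr 4; funext x; simp only [Function.comp, List.length_append, List.length_singleton]; omega

theorem sub_plug (L : List (Tm B)) {V : Tm B} (hV : V.IsValue) :
    ∀ M, Sub true M (plug L V) (plug L (Tm.inst L.length V M)) := by
  induction L using List.reverseRecOn with
  | nil => intro M; exact .inst M fun _ => hV
  | append_singleton L S ih =>
    intro M
    rw [plug_append, plug_append]
    convert Sub.es S rfl (ih _) using 3
    rw [inst_eq, inst_eq L.length, rename_rename, ← liftRen_comp]
    congr 3; funext x; simp only [Function.comp, List.length_append, List.length_singleton]; omega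

theorem Sub.exists_plug {M N R : Tm B} (h : Sub true M N R) :
    ∃ L V, V.IsValue ∧ N = plug L V ∧ R = plug L (Tm.inst L.length V M) := by
  induction h with
  | inst M hV => exact ⟨[], _, hV rfl, rfl, rfl⟩
  | es S _ h ih =>
    obtain ⟨L, V, hV, rfl, rfl⟩ := ih
    refine ⟨L ++ [S], V, hV, (plug_append _ _ _).symm, ?_⟩
    rw [plug_append, inst_eq, inst_eq (L ++ [S]).length, rename_rename, ← liftRen_comp]
    congr 5; funext x; simp only [Function.comp, List.length_append, List.length_singleton]; omega

theorem Beta.rename {Q N R : Tm B} (h : Beta Q N R) :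
    ∀ f : ℕ → ℕ, Beta (Q.rename f) (N.rename f) (R.rename f) := by
  induction h with
  | lam P N => exact fun f => .lam _ _
  | es S h ih =>
    intro f; refine .es _ ?_
    rw [← rename_rename_succ]; exact ih _

theorem Beta.subst {Q N R : Tm B} (h : Beta Q N R) :
    ∀ σ : ℕ → Tm B, Beta (Q.subst σ) (N.subst σ) (R.subst σ) := by
  induction h with
  | lam P N => exact fun f => .lam _ _
  | es S h ih =>
    intro f; refine .es _ ?_
    rw [← subst_rename_succ]; exact ih _

theorem Sub.rename {v : Bool} {M N R : Tm B} (h : Sub v M N R) :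
    ∀ f : ℕ → ℕ, Sub v (M.rename (liftRen f)) (N.rename f) (R.rename f) := by
  induction h with
  | inst M hV => intro f; rw [rename_inst]; exact .inst _ fun h => (hV h).rename f
  | es S hv h ih =>
    intro f; refine .es _ hv ?_
    convert ih (liftRen f) using 1
    rw [rename_rename, rename_rename, ← liftRen_comp, ← liftRen_comp]; rfl

/-- In dCBV variables count as values, so a redex whose argument is a variable survives only if
variables are replaced by values. -/
theorem Sub.subst {v : Bool} {M N R : Tm B} (h : Sub v M N R) :
    ∀ σ : ℕ → Tm B, (v = true → ∀ x, (σ x).IsValue) →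
      Sub v (M.subst (liftSub σ)) (N.subst σ) (R.subst σ) := by
  induction h with
  | inst M hV => intro σ hσ; rw [subst_inst]; exact .inst _ fun h => (hV h).subst (hσ h)
  | es S hv h ih =>
    intro σ hσ; refine .es _ hv ?_
    convert ih (liftSub σ) ?_ using 1
    · rw [rename_subst, subst_rename, rename_comp_liftSub, liftSub_comp_liftRen]; rfl
    · intro h x
      cases x
      · constructor
      · exact (hσ h _).rename _

/-- Firing `M[N/x]` commutes with firing an application of `M`. -/
theorem Sub.beta {v : Bool} {Q S T : Tm B} (h : Sub v Q S T) :
    ∀ {N R : Tm B}, Beta Q (N.rename Nat.succ) R → ∃ U, Beta T N U ∧ Sub v R S U := by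
  induction h with
  | @inst V Q hV =>
    intro N R hb
    refine ⟨_, ?_, .inst R hV⟩
    have := hb.subst (single V)
    rw [← inst_zero, ← inst_zero, inst_rename_succ, ← inst_zero] at this
    exact this
  | es S hv h ih =>
    intro N R hb
    have := hb.rename (liftRen Nat.succ)
    rw [rename_rename_succ] at this
    obtain ⟨U, h1, h2⟩ := ih this
    exact ⟨_, .es S h1, .es S hv h2⟩

theorem single_isValue {V : Tm B} (hV : V.IsValue) (x : ℕ) : (single V x).IsValue := by
  cases x
  · exact hV
  · constructor

/-- Local commutation for nested substitutions `M[Q[S/y]/x]`: the inner and the outer one may be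
fired in either order. The shift of `M` past `y` is undone when `y` is instantiated. -/
theorem Sub.sub {v : Bool} {Q S T : Tm B} (h : Sub v Q S T) :
    ∀ {M R : Tm B}, Sub v (M.rename (liftRen Nat.succ)) Q R → ∃ U, Sub v M T U ∧ Sub v R S U := by
  induction h with
  | inst Q hV =>
    intro M R hb
    refine ⟨_, ?_, .inst R hV⟩
    have := hb.subst (single _) fun h => single_isValue (hV h)
    rw [subst_single_liftRen_succ M, ← inst_zero, ← inst_zero] at this
    exact this
  | es S hv h ih =>
    intro M R hb
    have := hb.rename (liftRen Nat.succ)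
    rw [rename_rename, ← liftRen_comp] at this
    have e : (M.rename (liftRen (liftRen Nat.succ ∘ Nat.succ))) =
        (M.rename (liftRen Nat.succ)).rename (liftRen Nat.succ) := by
      rw [rename_rename, ← liftRen_comp]; rfl
    rw [e] at this
    obtain ⟨U, h1, h2⟩ := ih this
    exact ⟨_, .es S hv h1, .es S hv h2⟩

/-! ### The reductions -/

/-- One step of dCBV reduction if `v` holds, and of dCBN reduction otherwise. -/
inductive Step (v : Bool) : Term → Term → Prop
  | beta {M N R : Term} : Beta M N R → Step v (.app M N) R
  | sub {M N R : Term} : Sub v M N R → Step v (.es M N) R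
  | lam {M M' : Term} : Step v M M' → Step v (.lam M) (.lam M')
  | appL {M M' : Term} (N : Term) : Step v M M' → Step v (.app M N) (.app M' N)
  | appR (M : Term) {N N' : Term} : Step v N N' → Step v (.app M N) (.app M N')
  | esL {M M' : Term} (N : Term) : Step v M M' → Step v (.es M N) (.es M' N)
  | esR (M : Term) {N N' : Term} : Step v N N' → Step v (.es M N) (.es M N')

theorem stepV_iff {M N : Term} : StepV M N ↔ Step true M N := by
  constructor
  · intro h
    induction h with
    | beta L M N => exact .beta (beta_plug L M N)
    | subst L M V hV => exact .sub (sub_plug L hV M)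
    | lam _ ih => exact .lam ih
    | appL N _ ih => exact .appL N ih
    | appR N _ ih => exact .appR N ih
    | esL N _ ih => exact .esL N ih
    | esR N _ ih => exact .esR N ih
  · intro h
    induction h with
    | beta h => obtain ⟨L, P, rfl, rfl⟩ := h.exists_plug; exact .beta L P _
    | sub h => obtain ⟨L, V, hV, rfl, rfl⟩ := h.exists_plug; exact .subst L _ V hV
    | lam _ ih => exact .lam ih
    | appL N _ ih => exact .appL N ih
    | appR N _ ih => exact .appR N ih
    | esL N _ ih => exact .esL N ih
    | esR N _ ih => exact .esR N ih

theorem stepN_iff {M N : Term} : StepN M N ↔ Step false M N := by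
  constructor
  · intro h
    induction h with
    | beta L M N => exact .beta (beta_plug L M N)
    | subst M N => exact .sub (.inst M (by simp))
    | lam _ ih => exact .lam ih
    | appL N _ ih => exact .appL N ih
    | appR N _ ih => exact .appR N ih
    | esL N _ ih => exact .esL N ih
    | esR N _ ih => exact .esR N ih
  · intro h
    induction h with
    | beta h => obtain ⟨L, P, rfl, rfl⟩ := h.exists_plug; exact .beta L P _
    | sub h =>
      cases h with
      | inst _ _ => exact .subst _ _
      | es _ h _ => cases h
    | lam _ ih => exact .lam ih
    | appL N _ ih => exact .appL N ih
    | appR N _ ih => exact .appR N ih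
    | esL N _ ih => exact .esL N ih
    | esR N _ ih => exact .esR N ih

theorem stepV_eq : StepV = Step true := by
  funext M N; exact propext stepV_iff

theorem stepN_eq : StepN = Step false := by
  funext M N; exact propext stepN_iff

/-- The reflexive and transitive closure of `Step`. -/
abbrev Steps (v : Bool) : Term → Term → Prop := Relation.ReflTransGen (Step v)

namespace Steps

variable {v : Bool}

theorem lam {M M' : Term} (h : Steps v M M') : Steps v (.lam M) (.lam M') :=
  h.lift Tm.lam fun _ _ => .lam

theorem app {M M' N N' : Term} (h : Steps v M M') (h' : Steps v N N') :
    Steps v (.app M N) (.app M' N') :=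
  (h.lift (Tm.app · N) fun _ _ => .appL N).trans (h'.lift (Tm.app M') fun _ _ => .appR M')

theorem es {M M' N N' : Term} (h : Steps v M M') (h' : Steps v N N') :
    Steps v (.es M N) (.es M' N') :=
  (h.lift (Tm.es · N) fun _ _ => .esL N).trans (h'.lift (Tm.es M') fun _ _ => .esR M')

theorem plug {M M' : Term} (h : Steps v M M') (L : List Term) :
    Steps v (Tm.plug L M) (Tm.plug L M') := by
  induction L using List.reverseRecOn with
  | nil => exact h
  | append_singleton L S ih => rw [plug_append, plug_append]; exact ih.es .refl

end Steps

-- Stability of reduction under renaming and substitution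

theorem Step.rename {v : Bool} {M N : Term} (h : Step v M N) :
    ∀ f : ℕ → ℕ, Step v (M.rename f) (N.rename f) := by
  induction h with
  | beta h => exact fun f => .beta (h.rename f)
  | sub h => exact fun f => .sub (h.rename f)
  | lam _ ih => exact fun f => .lam (ih _)
  | appL N _ ih => exact fun f => .appL _ (ih _)
  | appR N _ ih => exact fun f => .appR _ (ih _)
  | esL N _ ih => exact fun f => .esL _ (ih _)
  | esR N _ ih => exact fun f => .esR _ (ih _)

theorem Step.subst {v : Bool} {M N : Term} (h : Step v M N) :
    ∀ σ : ℕ → Term, (v = true → ∀ x, (σ x).IsValue) → Step v (M.subst σ) (N.subst σ) := by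
  have lift : ∀ σ : ℕ → Term, (v = true → ∀ x, (σ x).IsValue) →
      (v = true → ∀ x, (liftSub σ x).IsValue) := by
    intro σ hσ hv x
    cases x
    · constructor
    · exact (hσ hv _).rename _
  induction h with
  | beta h => exact fun f _ => .beta (h.subst f)
  | sub h => exact fun f hf => .sub (h.subst f hf)
  | lam _ ih => exact fun f hf => .lam (ih _ (lift f hf))
  | appL N _ ih => exact fun f hf => .appL _ (ih _ hf)
  | appR N _ ih => exact fun f hf => .appR _ (ih _ hf)
  | esL N _ ih => exact fun f hf => .esL _ (ih _ (lift f hf))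
  | esR N _ ih => exact fun f hf => .esR _ (ih _ hf)

theorem Steps.rename {v : Bool} {M N : Term} (h : Steps v M N) (f : ℕ → ℕ) :
    Steps v (M.rename f) (N.rename f) :=
  h.lift (Tm.rename f) fun _ _ h => h.rename f

theorem Steps.subst {v : Bool} {M N : Term} (h : Steps v M N) {σ : ℕ → Term}
    (hσ : v = true → ∀ x, (σ x).IsValue) : Steps v (M.subst σ) (N.subst σ) :=
  h.lift (Tm.subst σ) fun _ _ h => h.subst σ hσ

/-! ### Confluence -/

/-- Parallel reduction, including redexes that are created by the reduction of subterms. -/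
inductive Par (v : Bool) : Term → Term → Prop
  | var (x : ℕ) : Par v (.var x) (.var x)
  | lam {M M' : Term} : Par v M M' → Par v (.lam M) (.lam M')
  | app {M M' N N' : Term} : Par v M M' → Par v N N' → Par v (.app M N) (.app M' N')
  | es {M M' N N' : Term} : Par v M M' → Par v N N' → Par v (.es M N) (.es M' N')
  | beta {M M' N N' R : Term} : Par v M M' → Par v N N' → Beta M' N' R → Par v (.app M N) R
  | sub {M M' N N' R : Term} : Par v M M' → Par v N N' → Sub v M' N' R → Par v (.es M N) R

namespace Par

variable {v : Bool}

theorem refl (M : Term) : Par v M M := by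
  induction M with
  | bot b => exact b.elim
  | var x => exact .var x
  | lam _ ih => exact .lam ih
  | app _ _ ih ih' => exact .app ih ih'
  | es _ _ ih ih' => exact .es ih ih'

theorem of_step {M N : Term} (h : Step v M N) : Par v M N := by
  induction h with
  | beta h => exact .beta (refl _) (refl _) h
  | sub h => exact .sub (refl _) (refl _) h
  | lam _ ih => exact .lam ih
  | appL N _ ih => exact .app ih (refl _)
  | appR N _ ih => exact .app (refl _) ih
  | esL N _ ih => exact .es ih (refl _)
  | esR N _ ih => exact .es (refl _) ih

theorem steps {M N : Term} (h : Par v M N) : Steps v M N := by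
  induction h with
  | var x => exact .refl
  | lam _ ih => exact ih.lam
  | app _ _ ih ih' => exact ih.app ih'
  | es _ _ ih ih' => exact ih.es ih'
  | beta _ _ h ih ih' => exact (ih.app ih').tail (.beta h)
  | sub _ _ h ih ih' => exact (ih.es ih').tail (.sub h)

theorem rename {M N : Term} (h : Par v M N) :
    ∀ f : ℕ → ℕ, Par v (M.rename f) (N.rename f) := by
  induction h with
  | var x => exact fun f => .var _
  | lam _ ih => exact fun f => .lam (ih _)
  | app _ _ ih ih' => exact fun f => .app (ih _) (ih' _)
  | es _ _ ih ih' => exact fun f => .es (ih _) (ih' _)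
  | beta _ _ h ih ih' => exact fun f => .beta (ih _) (ih' _) (h.rename f)
  | sub _ _ h ih ih' => exact fun f => .sub (ih _) (ih' _) (h.rename f)

theorem subst {M N : Term} (h : Par v M N) :
    ∀ σ τ : ℕ → Term, (∀ x, Par v (σ x) (τ x)) → (v = true → ∀ x, (τ x).IsValue) →
      Par v (M.subst σ) (N.subst τ) := by
  have lift : ∀ σ τ : ℕ → Term, (∀ x, Par v (σ x) (τ x)) →
      ∀ x, Par v (liftSub σ x) (liftSub τ x) := by
    intro σ τ h x
    cases x
    · exact .var 0
    · exact (h _).rename _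
  have lift' : ∀ τ : ℕ → Term, (v = true → ∀ x, (τ x).IsValue) →
      (v = true → ∀ x, (liftSub τ x).IsValue) := by
    intro τ hτ hv x
    cases x
    · constructor
    · exact (hτ hv _).rename _
  induction h with
  | var x => exact fun σ τ h _ => h x
  | lam _ ih => exact fun σ τ h hv => .lam (ih _ _ (lift _ _ h) (lift' _ hv))
  | app _ _ ih ih' => exact fun σ τ h hv => .app (ih _ _ h hv) (ih' _ _ h hv)
  | es _ _ ih ih' =>
    exact fun σ τ h hv => .es (ih _ _ (lift _ _ h) (lift' _ hv)) (ih' _ _ h hv)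
  | beta _ _ hb ih ih' =>
    exact fun σ τ h hv => .beta (ih _ _ h hv) (ih' _ _ h hv) (hb.subst τ)
  | sub _ _ hs ih ih' =>
    exact fun σ τ h hv => .sub (ih _ _ (lift _ _ h) (lift' _ hv)) (ih' _ _ h hv) (hs.subst τ hv)

theorem isValue {V V' : Term} (h : Par v V V') (hV : V.IsValue) : V'.IsValue := by
  cases hV with
  | var x => cases h; constructor
  | lam M => cases h; constructor

/-- A β-redex at a distance survives parallel reduction of its components. The delicate case is an
entry of the list context that is itself fired; then `Sub.beta` lets the two contractions commute.
-/
theorem of_beta {M N R : Term} (h : Beta M N R) :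
    ∀ {M' N' : Term}, Par v M M' → Par v N N' → ∃ R', Beta M' N' R' ∧ Par v R R' := by
  induction h with
  | lam P N =>
    intro M' N' hM hN
    cases hM with
    | lam hP => exact ⟨_, .lam _ _, .es hP hN⟩
  | es S h ih =>
    intro M' N' hM hN
    cases hM with
    | es hQ hS =>
      obtain ⟨R', hb, hR⟩ := ih hQ (hN.rename _)
      exact ⟨_, .es _ hb, .es hR hS⟩
    | sub hQ hS hs =>
      obtain ⟨R', hb, hR⟩ := ih hQ (hN.rename _)
      obtain ⟨U, hU, hU'⟩ := hs.beta hb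
      exact ⟨U, hU, .sub hR hS hU'⟩

theorem inst {M M' V V' : Term} (hM : Par v M M') (hV : Par v V V')
    (h : v = true → V'.IsValue) : Par v (Tm.inst 0 V M) (Tm.inst 0 V' M') := by
  rw [inst_zero, inst_zero]
  refine hM.subst _ _ (fun x => ?_) (fun e => single_isValue (h e))
  cases x
  · exact hV
  · exact .var _

theorem of_sub {M N R : Term} (h : Sub v M N R) :
    ∀ {M' N' : Term}, Par v M M' → Par v N N' → ∃ R', Sub v M' N' R' ∧ Par v R R' := by
  induction h with
  | inst M hV =>
    intro M' N' hM hN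
    exact ⟨_, .inst _ fun e => hN.isValue (hV e), hM.inst hN fun e => hN.isValue (hV e)⟩
  | es S hv h ih =>
    intro M' N' hM hN
    cases hN with
    | es hQ hS =>
      obtain ⟨R', hb, hR⟩ := ih (hM.rename _) hQ
      exact ⟨_, .es _ hv hb, .es hR hS⟩
    | sub hQ hS hs =>
      obtain ⟨R', hb, hR⟩ := ih (hM.rename _) hQ
      obtain ⟨U, hU, hU'⟩ := hs.sub hb
      exact ⟨U, hU, .sub hR hS hU'⟩

/-- Takahashi's method: `M'` is the complete development, obtained by developing the immediate
subterms and then firing the root if this has produced a redex there. Every parallel reduct of `M`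
can still be completed to it, because root redexes survive parallel reduction. -/
theorem exists_triangle (M : Term) : ∃ M', ∀ N, Par v M N → Par v N M' := by
  induction M with
  | bot b => exact b.elim
  | var x => exact ⟨.var x, fun N h => by cases h; exact .var x⟩
  | lam M ih =>
    obtain ⟨M', h⟩ := ih
    refine ⟨.lam M', fun N hN => ?_⟩
    cases hN with
    | lam hM => exact .lam (h _ hM)
  | app M N ihM ihN =>
    obtain ⟨M', hM⟩ := ihM
    obtain ⟨N', hN⟩ := ihN
    by_cases hb : ∃ R, Beta M' N' R
    · obtain ⟨R, hR⟩ := hb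
      refine ⟨R, fun P hP => ?_⟩
      cases hP with
      | app h1 h2 => exact .beta (hM _ h1) (hN _ h2) hR
      | beta h1 h2 h3 =>
        obtain ⟨R', h4, h5⟩ := of_beta h3 (hM _ h1) (hN _ h2)
        -- Root contraction is deterministic, so the redex surviving in the developed components
        -- contracts to the chosen `R`.
        have : R' = R := by
          clear h5 h3 hM hN
          induction hR generalizing R' with
          | lam P N => cases h4; rfl
          | es S _ ih => cases h4 with | es _ h => rw [ih _ h]
        exact this ▸ h5
    · refine ⟨.app M' N', fun P hP => ?_⟩
      cases hP with
      | app h1 h2 => exact .app (hM _ h1) (hN _ h2)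
      | beta h1 h2 h3 =>
        obtain ⟨R', h4, h5⟩ := of_beta h3 (hM _ h1) (hN _ h2)
        exact (hb ⟨_, h4⟩).elim
  | es M N ihM ihN =>
    obtain ⟨M', hM⟩ := ihM
    obtain ⟨N', hN⟩ := ihN
    by_cases hb : ∃ R, Sub v M' N' R
    · obtain ⟨R, hR⟩ := hb
      refine ⟨R, fun P hP => ?_⟩
      cases hP with
      | es h1 h2 => exact .sub (hM _ h1) (hN _ h2) hR
      | sub h1 h2 h3 =>
        obtain ⟨R', h4, h5⟩ := of_sub h3 (hM _ h1) (hN _ h2)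
        -- The two rules of `Sub` exclude each other: in dCBV an explicit substitution is not a
        -- value, and in dCBN the list-context rule is unavailable.
        have : R' = R := by
          clear h5 h3 hM hN
          induction hR generalizing R' with
          | inst M hV =>
            cases h4 with
            | inst => rfl
            | es _ hv _ => cases hV hv
          | es S hv _ ih =>
            cases h4 with
            | inst _ hV => cases hV hv
            | es _ _ h => rw [ih _ h]
        exact this ▸ h5
    · refine ⟨.es M' N', fun P hP => ?_⟩
      cases hP with
      | es h1 h2 => exact .es (hM _ h1) (hN _ h2)
      | sub h1 h2 h3 =>
        obtain ⟨R', h4, h5⟩ := of_sub h3 (hM _ h1) (hN _ h2)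
        exact (hb ⟨_, h4⟩).elim

end Par

/-- Parallel reduction lies between one step and many steps, and the triangle property gives it the
diamond property. -/
theorem Steps.confluent {v : Bool} {M N P : Term} (hN : Steps v M N) (hP : Steps v M P) :
    ∃ Q, Steps v N Q ∧ Steps v P Q := by
  have up : ∀ {a b : Term}, Steps v a b → Relation.ReflTransGen (Par v) a b :=
    fun h => Relation.ReflTransGen.mono (fun _ _ h => Par.of_step h) _ _ h
  have down : ∀ {a b : Term}, Relation.ReflTransGen (Par v) a b → Steps v a b := by
    intro a b h
    induction h with
    | refl => exact .refl
    | tail _ h ih => exact ih.trans h.steps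
  obtain ⟨Q, h1, h2⟩ := Relation.church_rosser (r := Par v) (fun a b c hb hc => by
    obtain ⟨d, hd⟩ := Par.exists_triangle (v := v) a
    exact ⟨d, .single (hd _ hb), .single (hd _ hc)⟩) (up hN) (up hP)
  exact ⟨Q, down h1, down h2⟩

/-! ### Resource terms: case analysis and induction -/

theorem PreRes.Equiv.bag {l l' : List PreRes} (h : List.Forall₂ PreRes.Equiv l l') :
    PreRes.Equiv (.bag l) (.bag l') := by
  -- `bagHead` rewrites only the head of a bag, so each element in turn is permuted to the front,
  -- rewritten, and put back. The prefix `p` collects the elements already treated.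
  suffices ∀ p : List PreRes, PreRes.Equiv (.bag (p ++ l)) (.bag (p ++ l')) from this []
  induction h with
  | nil => exact fun p => .refl _
  | @cons m m' l l' h _ ih =>
    intro p
    refine (PreRes.Equiv.bagPerm List.perm_middle).trans
      ((PreRes.Equiv.bagHead _ h).trans ((PreRes.Equiv.bagPerm List.perm_middle.symm).trans ?_))
    simpa using ih (p ++ [m'])

namespace Res

theorem mk_out (m : Res) : mk (out m) = m := Quotient.out_eq _

/-- `bag` is defined through chosen representatives of its elements; the choice does not matter,
since each is equivalent to the given one. -/
theorem mk_bag (l : List PreRes) : mk (.bag l) = bag (l.map mk : List Res) := by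
  refine Quotient.sound (PreRes.Equiv.bag ?_)
  rw [List.map_map, List.forall₂_map_right_iff, List.forall₂_same]
  exact fun m _ => Quotient.exact (mk_out (mk m)).symm

/-- The shapes of resource terms. -/
inductive View : Type
  | var : ℕ → View
  | lam : Res → View
  | app : Res → Res → View
  | es : Res → Res → View
  | der : Res → View
  | bag : Multiset Res → View

/-- The shape of a resource term, given by a representative. -/
def preView : PreRes → View
  | .var x => .var x
  | .lam m => .lam (mk m)
  | .app m n => .app (mk m) (mk n)
  | .es m n => .es (mk m) (mk n)
  | .der m => .der (mk m)
  | .bag l => .bag (l.map mk : List Res)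

/-- The shape of a resource term. -/
def view : Res → View :=
  Quotient.lift preView fun m n h => by
    have mk_eq : ∀ {m n : PreRes}, PreRes.Equiv m n → mk m = mk n := fun h => Quotient.sound h
    change PreRes.Equiv m n at h
    induction h with
    | refl => rfl
    | symm _ ih => exact ih.symm
    | trans _ _ ih ih' => exact ih.trans ih'
    | lam h => simp only [preView, mk_eq h]
    | app h h' => simp only [preView, mk_eq h, mk_eq h']
    | es h h' => simp only [preView, mk_eq h, mk_eq h']
    | der h => simp only [preView, mk_eq h]
    | bagPerm h => exact congrArg View.bag (Multiset.coe_eq_coe.2 (h.map mk))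
    | bagHead l h => simp only [preView, List.map_cons, mk_eq h]

@[simp] theorem view_var (x : ℕ) : view (var x) = .var x := rfl

@[simp] theorem view_lam (m : Res) : view (lam m) = .lam m := by
  induction m using Quotient.ind; rfl

@[simp] theorem view_app (m n : Res) : view (app m n) = .app m n := by
  induction m using Quotient.ind; induction n using Quotient.ind; rfl

@[simp] theorem view_es (m n : Res) : view (es m n) = .es m n := by
  induction m using Quotient.ind; induction n using Quotient.ind; rfl

@[simp] theorem view_der (m : Res) : view (der m) = .der m := by
  induction m using Quotient.ind; rfl

@[simp] theorem view_bag (s : Multiset Res) : view (bag s) = .bag s := by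
  induction s using Quotient.ind with | _ l
  change View.bag ((l.map out).map mk : List Res) = View.bag (l : List Res)
  rw [List.map_map]
  congr 2
  conv_rhs => rw [← List.map_id l]
  exact List.map_congr_left fun m _ => mk_out m

/-- Structural induction descends to the quotient: it is carried out on representatives, with the
induction hypothesis on bags phrased elementwise. -/
theorem ind {P : Res → Prop} (var : ∀ x, P (var x)) (lam : ∀ m, P m → P (lam m))
    (app : ∀ m n, P m → P n → P (app m n)) (es : ∀ m n, P m → P n → P (es m n))
    (der : ∀ m, P m → P (der m)) (bag : ∀ s : Multiset Res, (∀ m ∈ s, P m) → P (bag s))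
    (m : Res) : P m := by
  induction m using Quotient.ind with | _ m
  change P (mk m)
  refine PreRes.rec (motive_1 := fun m => P (mk m)) (motive_2 := fun l => ∀ m ∈ l, P (mk m))
    var (fun m h => lam _ h) (fun m n h h' => app _ _ h h') (fun m n h h' => es _ _ h h')
    (fun m h => der _ h) (fun l h => ?_) (by simp) (fun m l h h' => ?_) m
  · rw [mk_bag]
    refine bag _ fun m hm => ?_
    obtain ⟨n, hn, rfl⟩ := List.mem_map.1 (Multiset.mem_coe.1 hm)
    exact h n hn
  · intro n hn
    rcases List.mem_cons.1 hn with rfl | hn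
    · exact h
    · exact h' n hn

theorem bag_injective {s t : Multiset Res} (h : bag s = bag t) : s = t := by
  simpa using congrArg view h

@[simp] theorem rename_var (f : ℕ → ℕ) (x : ℕ) : rename f (var x) = var (f x) := by
  change mk _ = mk _
  rw [PreRes.rename]

@[simp] theorem rename_lam (f : ℕ → ℕ) (m : Res) :
    rename f (lam m) = lam (rename (liftRen f) m) := by
  induction m using Quotient.ind
  change mk _ = mk _
  rw [PreRes.rename]

@[simp] theorem rename_app (f : ℕ → ℕ) (m n : Res) :
    rename f (app m n) = app (rename f m) (rename f n) := by
  induction m using Quotient.ind; induction n using Quotient.ind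
  change mk _ = mk _
  rw [PreRes.rename]

@[simp] theorem rename_es (f : ℕ → ℕ) (m n : Res) :
    rename f (es m n) = es (rename (liftRen f) m) (rename f n) := by
  induction m using Quotient.ind; induction n using Quotient.ind
  change mk _ = mk _
  rw [PreRes.rename]

@[simp] theorem rename_der (f : ℕ → ℕ) (m : Res) : rename f (der m) = der (rename f m) := by
  induction m using Quotient.ind
  change mk _ = mk _
  rw [PreRes.rename]

@[simp] theorem rename_bag (f : ℕ → ℕ) (s : Multiset Res) :
    rename f (bag s) = bag (s.map (rename f)) := by
  induction s using Quotient.ind with | _ l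
  change mk (PreRes.rename f (.bag (l.map out))) = bag (l.map (rename f) : List Res)
  rw [PreRes.rename, PreRes.renameList_eq, mk_bag, List.map_map, List.map_map]
  congr 2
  refine List.map_congr_left fun m _ => ?_
  change rename f (mk (out m)) = rename f m
  rw [mk_out]

@[simp] theorem degree_var (d x : ℕ) : degree d (var x) = if d = x then 1 else 0 := by
  change PreRes.degree _ _ = _
  rw [PreRes.degree]

@[simp] theorem degree_lam (d : ℕ) (m : Res) : degree d (lam m) = degree (d + 1) m := by
  induction m using Quotient.ind
  change PreRes.degree _ _ = PreRes.degree _ _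
  rw [PreRes.degree]

@[simp] theorem degree_app (d : ℕ) (m n : Res) :
    degree d (app m n) = degree d m + degree d n := by
  induction m using Quotient.ind; induction n using Quotient.ind
  change PreRes.degree _ _ = PreRes.degree _ _ + PreRes.degree _ _
  rw [PreRes.degree]

@[simp] theorem degree_es (d : ℕ) (m n : Res) :
    degree d (es m n) = degree (d + 1) m + degree d n := by
  induction m using Quotient.ind; induction n using Quotient.ind
  change PreRes.degree _ _ = PreRes.degree _ _ + PreRes.degree _ _
  rw [PreRes.degree]

@[simp] theorem degree_der (d : ℕ) (m : Res) : degree d (der m) = degree d m := by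
  induction m using Quotient.ind
  change PreRes.degree _ _ = PreRes.degree _ _
  rw [PreRes.degree]

@[simp] theorem degree_bag (d : ℕ) (s : Multiset Res) :
    degree d (bag s) = (s.map (degree d)).sum := by
  induction s using Quotient.ind with | _ l
  change PreRes.degree d (.bag (l.map out)) = (Multiset.map (degree d) (l : Multiset Res)).sum
  rw [PreRes.degree, PreRes.degreeList_eq, List.map_map, Multiset.map_coe, Multiset.sum_coe]
  congr 1
  refine List.map_congr_left fun m _ => ?_
  change degree d (mk (out m)) = degree d m
  rw [mk_out]

theorem plug_append (l : List Res) (m n : Res) : plug (l ++ [n]) m = es (plug l m) n := by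
  simp [plug]

/-- The terms `l⟨q⟩` with `q` in `P`. -/
def Spine (P : Res → Prop) (m : Res) : Prop := ∃ l q, P q ∧ m = plug l q

theorem Spine.of {P : Res → Prop} {m : Res} (h : P m) : Spine P m := ⟨[], m, h, rfl⟩

theorem Spine.elim {P : Res → Prop} {m : Res} (h : Spine P m) :
    P m ∨ ∃ m' n, m = es m' n ∧ Spine P m' := by
  obtain ⟨l, q, hq, rfl⟩ := h
  rcases List.eq_nil_or_concat l with rfl | ⟨l, n, rfl⟩
  · exact .inl hq
  · exact .inr ⟨plug l q, n, by rw [List.concat_eq_append, plug_append], l, q, hq, rfl⟩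

theorem Spine.es {P : Res → Prop} {m : Res} (h : Spine P m) (n : Res) : Spine P (es m n) := by
  obtain ⟨l, q, hq, rfl⟩ := h
  exact ⟨l ++ [n], q, hq, (plug_append _ _ _).symm⟩

/-- The terms `l⟨[n₁, …, nₖ]⟩`. -/
def BagSpine : Res → Prop := Spine fun q => ∃ s, q = bag s

/-- The terms `l⟨λx m⟩`. -/
def LamSpine : Res → Prop := Spine fun q => ∃ m, q = lam m

theorem bagSpine_bag (s : Multiset Res) : BagSpine (bag s) := Spine.of ⟨s, rfl⟩

theorem lamSpine_lam (m : Res) : LamSpine (lam m) := Spine.of ⟨m, rfl⟩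

@[simp] theorem bagSpine_es (m n : Res) : BagSpine (es m n) ↔ BagSpine m := by
  refine ⟨fun h => ?_, fun h => h.es n⟩
  rcases h.elim with ⟨s, h⟩ | ⟨m', n', h, h'⟩
  · simpa using congrArg view h
  · have := congrArg view h
    simp only [view_es, View.es.injEq] at this
    exact this.1 ▸ h'

@[simp] theorem lamSpine_es (m n : Res) : LamSpine (es m n) ↔ LamSpine m := by
  refine ⟨fun h => ?_, fun h => h.es n⟩
  rcases h.elim with ⟨s, h⟩ | ⟨m', n', h, h'⟩
  · simpa using congrArg view h
  · have := congrArg view h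
    simp only [view_es, View.es.injEq] at this
    exact this.1 ▸ h'

theorem not_bagSpine_app (m n : Res) : ¬ BagSpine (app m n) := by
  intro h
  rcases h.elim with ⟨s, h⟩ | ⟨m', n', h, h'⟩ <;> simpa using congrArg view h

theorem not_lamSpine_var (x : ℕ) : ¬ LamSpine (var x) := by
  intro h
  rcases h.elim with ⟨s, h⟩ | ⟨m', n', h, h'⟩ <;> simpa using congrArg view h

theorem not_lamSpine_app (m n : Res) : ¬ LamSpine (app m n) := by
  intro h
  rcases h.elim with ⟨s, h⟩ | ⟨m', n', h, h'⟩ <;> simpa using congrArg view h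

theorem not_lamSpine_der (m : Res) : ¬ LamSpine (der m) := by
  intro h
  rcases h.elim with ⟨s, h⟩ | ⟨m', n', h, h'⟩ <;> simpa using congrArg view h

end Res

/-! ### Linear substitution -/

theorem exists_add_of_card {α : Type} {s : Multiset α} {a b : ℕ} (h : a + b = s.card) :
    ∃ t u : Multiset α, s = t + u ∧ a = t.card ∧ b = u.card := by
  induction s using Quotient.ind with | _ l
  refine ⟨(l.take a : List α), (l.drop a : List α), ?_, ?_, ?_⟩
  · change (l : Multiset α) = _
    rw [Multiset.coe_add, List.take_append_drop]
  all_goals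
    change a + b = l.length at h
    simp only [Multiset.coe_card, List.length_take, List.length_drop]
    omega

/-- At every node the multiset is cut into pieces of the sizes dictated by the degrees of the
subterms. Consequently the substitution rule is never stuck when the numbers agree, whatever the
shape of the terms. -/
theorem LinSubst.exists_of_degree (k : ℕ) (m : Res) :
    ∀ (d : ℕ) (s : Multiset Res), m.degree d = s.card → ∃ r, LinSubst k d s m r := by
  induction m using Res.ind with
  | var x =>
    intro d s h
    rw [Res.degree_var] at h
    split at h
    · subst x
      obtain ⟨n, rfl⟩ := Multiset.card_eq_one.1 h.symm
      exact ⟨_, .hit d n⟩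
    · obtain rfl := Multiset.card_eq_zero.1 h.symm
      rcases Nat.lt_or_ge x d with hx | hx
      · exact ⟨_, .lt hx⟩
      · obtain ⟨y, rfl⟩ : ∃ y, x = y + 1 := ⟨x - 1, by omega⟩
        exact ⟨_, .gt (by omega)⟩
  | lam m ih =>
    intro d s h
    rw [Res.degree_lam] at h
    obtain ⟨r, hr⟩ := ih (d + 1) (s.map (Res.rename Nat.succ)) (by simpa using h)
    exact ⟨_, .lam hr⟩
  | app m n ih ih' =>
    intro d s h
    rw [Res.degree_app] at h
    obtain ⟨t, u, rfl, ht, hu⟩ := exists_add_of_card h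
    obtain ⟨r, hr⟩ := ih d t ht
    obtain ⟨r', hr'⟩ := ih' d u hu
    exact ⟨_, .app hr hr'⟩
  | es m n ih ih' =>
    intro d s h
    rw [Res.degree_es] at h
    obtain ⟨t, u, rfl, ht, hu⟩ := exists_add_of_card h
    obtain ⟨r, hr⟩ := ih (d + 1) (t.map (Res.rename Nat.succ)) (by simpa using ht)
    obtain ⟨r', hr'⟩ := ih' d u hu
    exact ⟨_, .es hr hr'⟩
  | der m ih =>
    intro d s h
    rw [Res.degree_der] at h
    obtain ⟨r, hr⟩ := ih d s h
    exact ⟨_, .der hr⟩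
  | bag u ih =>
    intro d
    suffices ∀ s : Multiset Res, (Res.bag u).degree d = s.card →
        ∃ u', LinSubst k d s (.bag u) (.bag u') from
      fun s h => (this s h).imp' Res.bag fun _ h => h
    induction u using Multiset.induction with
    | empty =>
      intro s h
      obtain rfl := Multiset.card_eq_zero.1 (h.symm.trans (by simp))
      exact ⟨_, .bagNil d⟩
    | cons m u ihu =>
      intro s h
      rw [Res.degree_bag, Multiset.map_cons, Multiset.sum_cons] at h
      obtain ⟨t, v, rfl, ht, hv⟩ := exists_add_of_card h
      obtain ⟨r, hr⟩ := ih m (Multiset.mem_cons_self m u) d t ht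
      obtain ⟨r', hr'⟩ := ihu (fun m hm => ih m (Multiset.mem_cons_of_mem hm)) v
        (by rw [Res.degree_bag, hv])
      exact ⟨_, .bagCons hr hr'⟩

/-! ### Normal resource terms -/

namespace Res

theorem isNormal_var (x : ℕ) : IsNormal (var x) := by
  intro o h
  -- Resource terms form a quotient, so case analysis on `StepR` cannot unify its indices. The term
  -- is generalised, and the views on both sides then decide which rules can apply; the same device
  -- recurs below.
  generalize e : var x = q at h
  replace e := congrArg view e
  cases h <;> simp at e

theorem isNormal_lam {m : Res} : IsNormal (lam m) ↔ IsNormal m := by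
  refine ⟨fun h o ho => h _ (.lam ho), fun hm o h => ?_⟩
  generalize e : lam m = q at h
  replace e := congrArg view e
  cases h <;> simp at e
  case lam h => exact hm _ (e ▸ h)

theorem isNormal_app {m n : Res} :
    IsNormal (app m n) ↔ ¬ LamSpine m ∧ IsNormal m ∧ IsNormal n := by
  refine ⟨fun h => ⟨?_, fun o ho => h _ (.appL n ho), fun o ho => h _ (.appR m ho)⟩, ?_⟩
  · rintro ⟨l, _, ⟨p, rfl⟩, rfl⟩
    exact h _ (.beta l p n)
  · rintro ⟨h1, h2, h3⟩ o h
    generalize e : app m n = q at h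
    replace e := congrArg view e
    cases h <;> simp at e
    case beta l p n' => exact h1 ⟨l, _, ⟨p, rfl⟩, e.1⟩
    case appL h => exact h2 _ (e.1 ▸ h)
    case appR h => exact h3 _ (e.2 ▸ h)

/-- An argument `l⟨[n₁, …, nₖ]⟩` always makes a redex: it is substituted when `k` is the number of
occurrences, and otherwise gives `∅`. -/
theorem isNormal_es {m n : Res} :
    IsNormal (es m n) ↔ ¬ BagSpine n ∧ IsNormal m ∧ IsNormal n := by
  refine ⟨fun h => ⟨?_, fun o ho => h _ (.esL n ho), fun o ho => h _ (.esR m ho)⟩, ?_⟩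
  · rintro ⟨l, _, ⟨s, rfl⟩, rfl⟩
    by_cases hs : m.degree 0 = s.card
    · obtain ⟨r, hr⟩ := LinSubst.exists_of_degree l.length m 0 s hs
      exact h _ (.subst l s m r hr)
    · exact h _ (.substEmpty l s m hs)
  · rintro ⟨h1, h2, h3⟩ o h
    generalize e : es m n = q at h
    replace e := congrArg view e
    cases h <;> simp at e
    case subst l s m r _ => exact h1 ⟨l, _, ⟨s, rfl⟩, e.2⟩
    case substEmpty l s m _ => exact h1 ⟨l, _, ⟨s, rfl⟩, e.2⟩
    case esL h => exact h2 _ (e.1 ▸ h)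
    case esR h => exact h3 _ (e.2 ▸ h)

theorem isNormal_der {m : Res} : IsNormal (der m) ↔ ¬ BagSpine m ∧ IsNormal m := by
  refine ⟨fun h => ⟨?_, fun o ho => h _ (.der ho)⟩, ?_⟩
  · rintro ⟨l, _, ⟨s, rfl⟩, rfl⟩
    by_cases hs : s.card = 1
    · obtain ⟨m, rfl⟩ := Multiset.card_eq_one.1 hs
      exact h _ (.derBag l m)
    · exact h _ (.derEmpty l s hs)
  · rintro ⟨h1, h2⟩ o h
    generalize e : der m = q at h
    replace e := congrArg view e
    cases h <;> simp at e
    case derBag l m => exact h1 ⟨l, _, ⟨{m}, rfl⟩, e⟩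
    case derEmpty l s _ => exact h1 ⟨l, _, ⟨s, rfl⟩, e⟩
    case der h => exact h2 _ (e ▸ h)

theorem isNormal_bag {s : Multiset Res} : IsNormal (bag s) ↔ ∀ m ∈ s, IsNormal m := by
  refine ⟨fun h m hm o ho => ?_, fun hs o h => ?_⟩
  · obtain ⟨t, rfl⟩ := Multiset.exists_cons_of_mem hm
    exact h _ (.bag t ho)
  · generalize e : bag s = q at h
    replace e := congrArg view e
    cases h <;> simp at e
    case bag h => exact hs _ (e ▸ Multiset.mem_cons_self _ _) _ h

end Res

/-! ### Sequences of resource reduction steps -/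

/-- The reflexive and transitive closure of resource reduction. -/
abbrev StepsR : Res → Res → Prop := Relation.ReflTransGen fun a b => StepR a (some b)

namespace StepsR

theorem lam {m m' : Res} (h : StepsR m m') : StepsR m.lam m'.lam :=
  h.lift Res.lam fun _ _ h => StepR.lam h

theorem der {m m' : Res} (h : StepsR m m') : StepsR m.der m'.der :=
  h.lift Res.der fun _ _ h => StepR.der h

theorem app {m m' n n' : Res} (h : StepsR m m') (h' : StepsR n n') :
    StepsR (m.app n) (m'.app n') :=
  (h.lift (Res.app · n) fun _ _ h => StepR.appL n h).trans
    (h'.lift (Res.app m') fun _ _ h => StepR.appR m' h)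

theorem es {m m' n n' : Res} (h : StepsR m m') (h' : StepsR n n') :
    StepsR (m.es n) (m'.es n') :=
  (h.lift (Res.es · n) fun _ _ h => StepR.esL n h).trans
    (h'.lift (Res.es m') fun _ _ h => StepR.esR m' h)

theorem bag {s t : Multiset Res} (h : Multiset.Rel StepsR s t) : StepsR (.bag s) (.bag t) := by
  suffices ∀ u, StepsR (.bag (u + s)) (.bag (u + t)) by simpa using this 0
  induction h with
  | zero => exact fun u => .refl
  | @cons m m' s t h _ ih =>
    intro u
    have h1 : StepsR (.bag (m ::ₘ (u + s))) (.bag (m' ::ₘ (u + s))) :=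
      h.lift (fun m => Res.bag (m ::ₘ (u + s))) fun _ _ h => StepR.bag _ h
    have h2 := ih (m' ::ₘ u)
    rw [Multiset.add_cons, Multiset.add_cons]
    rw [Multiset.cons_add, Multiset.cons_add] at h2
    exact h1.trans h2

end StepsR

/-- A property of the elements of a multiset that is witnessed elementwise. -/
theorem exists_rel_of_forall {α β : Type} {r : α → β → Prop} {P : α → Prop}
    {t : Multiset β} (h : ∀ b ∈ t, ∃ a, P a ∧ r a b) :
    ∃ s : Multiset α, (∀ a ∈ s, P a) ∧ Multiset.Rel r s t := by
  induction t using Multiset.induction with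
  | empty => exact ⟨0, by simp, .zero⟩
  | cons b t ih =>
    obtain ⟨a, ha, hr⟩ := h b (Multiset.mem_cons_self b t)
    obtain ⟨s, hs, hr'⟩ := ih fun b hb => h b (Multiset.mem_cons_of_mem hb)
    refine ⟨a ::ₘ s, fun c hc => ?_, .cons hr hr'⟩
    rcases Multiset.mem_cons.1 hc with rfl | hc
    · exact ha
    · exact hs _ hc

/-- Finite choice, one preimage for each occurrence in the multiset. It rebuilds a bag of
approximations from individual ones. -/
theorem exists_map_of_forall {α β : Type} {f : α → β} {P : α → Prop}
    {t : Multiset β} (h : ∀ b ∈ t, ∃ a, P a ∧ f a = b) :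
    ∃ s : Multiset α, (∀ a ∈ s, P a) ∧ s.map f = t := by
  obtain ⟨s, hs, hr⟩ := exists_rel_of_forall h
  refine ⟨s, hs, ?_⟩
  clear hs h
  induction hr with
  | zero => rfl
  | cons h _ ih => rw [Multiset.map_cons, h, ih]

/-! ### The substitutions that instantiate one variable -/

/-- The parallel substitution `σ` performs, below `d` binders, the instantiation of one variable
by `W` followed by the addition of `k` binders. -/
def InstAt {B : Type} (k d : ℕ) (W : Tm B) (σ : ℕ → Tm B) : Prop :=
  (∀ x < d, σ x = .var x) ∧ σ d = W ∧ ∀ x, d ≤ x → σ (x + 1) = .var (x + k)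

namespace InstAt

variable {k d : ℕ} {W : Tm B} {σ : ℕ → Tm B}

theorem lift (h : InstAt k d W σ) : InstAt k (d + 1) (W.rename Nat.succ) (liftSub σ) := by
  obtain ⟨h1, h2, h3⟩ := h
  refine ⟨fun x hx => ?_, congrArg _ h2, fun x hx => ?_⟩
  · cases x with
    | zero => rfl
    | succ x => simp only [liftSub, h1 x (by omega), Tm.rename]
  · cases x with
    | zero => omega
    | succ x =>
      simp only [liftSub, h3 x (by omega), Tm.rename]
      congr 1; omega

theorem cases (h : InstAt k d W σ) (x : ℕ) :
    (x < d ∧ σ x = .var x) ∨ (x = d ∧ σ x = W) ∨ ∃ y, d ≤ y ∧ x = y + 1 ∧ σ x = .var (y + k) := by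
  obtain ⟨h1, h2, h3⟩ := h
  rcases lt_trichotomy x d with hx | rfl | hx
  · exact .inl ⟨hx, h1 x hx⟩
  · exact .inr (.inl ⟨rfl, h2⟩)
  · obtain ⟨y, rfl⟩ : ∃ y, x = y + 1 := ⟨x - 1, by omega⟩
    exact .inr (.inr ⟨y, by omega, rfl, h3 y (by omega)⟩)

theorem isValue (h : InstAt k d W σ) (hW : W.IsValue) (x : ℕ) : (σ x).IsValue := by
  rcases h.cases x with ⟨-, h⟩ | ⟨-, h⟩ | ⟨y, -, -, h⟩ <;> rw [h]
  · constructor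
  · exact hW
  · constructor

end InstAt

/-! ### Answers -/

namespace Tm

theorem isAnswer_elim {M : Tm B} (h : M.IsAnswer) :
    M.IsValue ∨ ∃ M' N, M = .es M' N ∧ M'.IsAnswer := by
  obtain ⟨L, V, hV, rfl⟩ := h
  rcases List.eq_nil_or_concat L with rfl | ⟨L, N, rfl⟩
  · exact .inl hV
  · exact .inr ⟨plug L V, N, by rw [List.concat_eq_append, plug_append], L, V, hV, rfl⟩

theorem IsValue.isAnswer {V : Tm B} (h : V.IsValue) : V.IsAnswer := ⟨[], V, h, rfl⟩

@[simp] theorem isAnswer_var (x : ℕ) : (var x : Tm B).IsAnswer := (IsValue.var x).isAnswer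

@[simp] theorem isAnswer_lam (M : Tm B) : (lam M).IsAnswer := (IsValue.lam M).isAnswer

@[simp] theorem not_isAnswer_bot (b : B) : ¬ (bot b).IsAnswer := by
  intro h
  rcases isAnswer_elim h with h | ⟨_, _, h, _⟩ <;> cases h

@[simp] theorem not_isAnswer_app (M N : Tm B) : ¬ (app M N).IsAnswer := by
  intro h
  rcases isAnswer_elim h with h | ⟨_, _, h, _⟩ <;> cases h

@[simp] theorem isAnswer_es (M N : Tm B) : (es M N).IsAnswer ↔ M.IsAnswer := by
  constructor
  · intro h
    rcases isAnswer_elim h with h | ⟨_, _, h, h'⟩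
    · cases h
    · cases h; exact h'
  · rintro ⟨L, V, hV, rfl⟩
    exact ⟨L ++ [N], V, hV, (plug_append _ _ _).symm⟩

@[simp] theorem isAnswer_rename (M : Tm B) :
    ∀ f : ℕ → ℕ, (M.rename f).IsAnswer ↔ M.IsAnswer := by
  induction M <;> intro f <;> simp_all [Tm.rename]

theorem isAnswer_subst (M : Tm B) : ∀ σ : ℕ → Tm B, (∀ x, (σ x).IsValue) →
    ((M.subst σ).IsAnswer ↔ M.IsAnswer) := by
  induction M with
  | bot b => intro σ _; simp [Tm.subst]
  | var x => intro σ h; simp [Tm.subst, (h x).isAnswer]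
  | lam M _ => intro σ _; simp [Tm.subst]
  | app M N _ _ => intro σ _; simp [Tm.subst]
  | es M N ih _ =>
    intro σ h
    simp only [Tm.subst, isAnswer_es]
    refine ih _ fun x => ?_
    cases x
    · constructor
    · exact (h _).rename _

theorem isAnswer_plug (L : List (Tm B)) (M : Tm B) : (plug L M).IsAnswer ↔ M.IsAnswer := by
  induction L using List.reverseRecOn with
  | nil => rfl
  | append_singleton L N ih => rw [plug_append, isAnswer_es, ih]

end Tm

theorem Beta.isAnswer {B : Type} {M N R : Tm B} (h : Beta M N R) : M.IsAnswer := by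
  induction h with
  | lam => simp
  | es _ _ ih => simpa using ih

theorem Sub.isAnswer {B : Type} {M N R : Tm B} (h : Sub true M N R) : N.IsAnswer := by
  induction h with
  | inst _ h => exact (h rfl).isAnswer
  | es _ _ _ ih => simpa using ih

theorem Steps.isValue {v : Bool} {V W : Term} (h : Steps v V W) (hV : V.IsValue) : W.IsValue := by
  induction h with
  | refl => exact hV
  | tail _ h ih =>
    cases ih with
    | var => cases h
    | lam => cases h; constructor

/-! ### dCBV resource approximation, without list contexts -/

/-- If `b` holds, `ApproxSpine b m M` is the dCBV resource approximation of `M` by `m`.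
Otherwise, it means that `m = l⟨n⟩` where `l⟨[n]⟩` is an approximation of `M = L⟨V⟩`. -/
inductive ApproxSpine {B : Type} : Bool → Res → Tm B → Prop
  | var (x : ℕ) : ApproxSpine false (.var x) (.var x)
  | lam {m : Res} {M : Tm B} : ApproxSpine true m M → ApproxSpine false (.lam m) (.lam M)
  | es {b : Bool} {m n : Res} {M N : Tm B} :
      ApproxSpine b m M → ApproxSpine true n N → ApproxSpine b (.es m n) (.es M N)
  | bag {s : Multiset Res} {V : Tm B} :
      V.IsValue → (∀ v ∈ s, ApproxSpine false v V) → ApproxSpine true (.bag s) V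
  | appDer {m n : Res} {M N : Tm B} : ¬ M.IsAnswer →
      ApproxSpine true m M → ApproxSpine true n N → ApproxSpine true (.app (.der m) n) (.app M N)
  | appSpine {m n : Res} {M N : Tm B} :
      ApproxSpine false m M → ApproxSpine true n N → ApproxSpine true (.app m n) (.app M N)

namespace ApproxSpine

theorem inv_es {b : Bool} {m n : Res} {M : Tm B} (h : ApproxSpine b (.es m n) M) :
    ∃ M' N, M = .es M' N ∧ ApproxSpine b m M' ∧ ApproxSpine true n N := by
  generalize e : Res.es m n = q at h
  replace e := congrArg Res.view e
  cases h <;> simp at e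
  case es h h' => exact ⟨_, _, rfl, e.1 ▸ h', e.2 ▸ h⟩

theorem inv_bag {b : Bool} {s : Multiset Res} {M : Tm B} (h : ApproxSpine b (.bag s) M) :
    M.IsValue ∧ ∀ v ∈ s, ApproxSpine false v M := by
  generalize e : Res.bag s = q at h
  replace e := congrArg Res.view e
  cases h <;> simp at e
  case bag h h' => exact ⟨h, e ▸ h'⟩

theorem isAnswer {m : Res} {M : Tm B} (h : ApproxSpine false m M) : M.IsAnswer := by
  generalize e : false = b at h
  induction h with
  | var => simp
  | lam => simp
  | es _ _ ih _ => simpa using ih e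
  | bag => cases e
  | appDer => cases e
  | appSpine => cases e

/-- Being an answer is visible on the resource side. The side condition of the application rule can
thus be transported between any two terms approximated by the same resource term. -/
theorem bagSpine_iff {m : Res} {M : Tm B} (h : ApproxSpine true m M) :
    m.BagSpine ↔ M.IsAnswer := by
  generalize e : true = b at h
  induction h with
  | var => cases e
  | lam => cases e
  | es _ _ ih _ => simpa using ih e
  | bag h => exact iff_of_true (Res.bagSpine_bag _) h.isAnswer
  | appDer => simp [Res.not_bagSpine_app]
  | appSpine => simp [Res.not_bagSpine_app]

theorem of_plug_bag (l : List Res) {m : Res} :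
    ∀ {M : Tm B}, ApproxSpine true (.plug l (.bag {m})) M → ApproxSpine false (.plug l m) M := by
  induction l using List.reverseRecOn with
  | nil => exact fun h => h.inv_bag.2 m (Multiset.mem_singleton_self m)
  | append_singleton l n ih =>
    intro M h
    rw [Res.plug_append] at h ⊢
    obtain ⟨M', N, rfl, h1, h2⟩ := h.inv_es
    exact .es (ih h1) h2

theorem of_approxV {m : Res} {M : Tm B} (h : ApproxV m M) : ApproxSpine true m M := by
  induction h with
  | var k x =>
    refine .bag (.var x) fun v hv => ?_
    rw [Multiset.eq_of_mem_replicate hv]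
    exact .var x
  | lam _ ih =>
    refine .bag (.lam _) fun v hv => ?_
    obtain ⟨m, hm, rfl⟩ := Multiset.mem_map.1 hv
    exact .lam (ih m hm)
  | app h _ _ ih ih' => exact .appDer h ih ih'
  | appAnswer _ _ _ ih ih' => exact .appSpine (of_plug_bag _ ih) ih'
  | es _ _ ih ih' => exact .es ih ih'

/-- The two judgements are translated together, because an application whose function is an answer
requires the decomposition `l⟨n⟩` of the approximation of that function. -/
theorem approxV_aux (M : Tm B) : (∀ m, ApproxSpine true m M → ApproxV m M) ∧
    ∀ m, ApproxSpine false m M → ∃ l n, m = .plug l n ∧ ApproxV (.plug l (.bag {n})) M := by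
  induction M with
  | bot b =>
    refine ⟨fun m h => ?_, fun m h => by cases h⟩
    cases h with
    | bag h _ => cases h
  | var x =>
    refine ⟨fun m h => ?_, fun m h => ?_⟩
    · cases h with
      | bag _ h =>
        rename_i s
        have e := Multiset.eq_replicate_card.2 fun v hv =>
          show v = Res.var x by cases h v hv; rfl
        rw [e]
        exact .var _ x
    · cases h
      exact ⟨[], _, rfl, .var 1 x⟩
  | lam M ih =>
    refine ⟨fun m h => ?_, fun m h => ?_⟩
    · cases h with
      | bag _ h =>
        obtain ⟨s, hs, rfl⟩ := exists_map_of_forall (f := Res.lam) (P := (ApproxV · M))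
          fun v hv => by
            cases h v hv with
            | lam h => exact ⟨_, ih.1 _ h, rfl⟩
        exact .lam hs
    · cases h with
      | @lam m _ h =>
        refine ⟨[], _, rfl, ?_⟩
        have := ApproxV.lam (s := {m}) (M := M) fun n hn => by
          rw [Multiset.mem_singleton.1 hn]; exact ih.1 _ h
        rwa [Multiset.map_singleton] at this
  | app M N ihM ihN =>
    refine ⟨fun m h => ?_, fun m h => by cases h⟩
    cases h with
    | bag h _ => cases h
    | appDer h h1 h2 => exact .app h (ihM.1 _ h1) (ihN.1 _ h2)
    | appSpine h1 h2 =>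
      obtain ⟨l, n, rfl, h⟩ := ihM.2 _ h1
      exact .appAnswer h1.isAnswer h (ihN.1 _ h2)
  | es M N ihM ihN =>
    refine ⟨fun m h => ?_, fun m h => ?_⟩
    · cases h with
      | bag h _ => cases h
      | es h1 h2 => exact .es (ihM.1 _ h1) (ihN.1 _ h2)
    · cases h with
      | es h1 h2 =>
        obtain ⟨l, n, rfl, h⟩ := ihM.2 _ h1
        refine ⟨l ++ [_], n, (Res.plug_append _ _ _).symm, ?_⟩
        rw [Res.plug_append]
        exact .es h (ihN.1 _ h2)

end ApproxSpine

theorem approxV_iff {B : Type} {m : Res} {M : Tm B} : ApproxV m M ↔ ApproxSpine true m M :=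
  ⟨.of_approxV, (ApproxSpine.approxV_aux M).1 m⟩

-- Pulling dCBV approximations back along renaming, substitution and reduction

namespace ApproxSpine

/-- Approximation follows the shape of the term, which renaming leaves unchanged; injectivity of `f`
plays no role. It serves to undo the shifts introduced by β-reduction and by crossing binders. -/
theorem inv_rename (M : Tm B) : ∀ {b : Bool} {m : Res} (f : ℕ → ℕ),
    ApproxSpine b m (M.rename f) → ∃ n, n.rename f = m ∧ ApproxSpine b n M := by
  have bag : ∀ (V : Tm B) (f : ℕ → ℕ) (s : Multiset Res), V.IsValue →
      (∀ v ∈ s, ∃ n, n.rename f = v ∧ ApproxSpine false n V) →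
      ∃ n, n.rename f = Res.bag s ∧ ApproxSpine true n V := by
    intro V f s hV h
    obtain ⟨t, ht, rfl⟩ := exists_map_of_forall (f := Res.rename f)
      (P := (ApproxSpine false · V)) fun v hv => (h v hv).imp fun _ h => h.symm
    exact ⟨_, Res.rename_bag _ _, .bag hV ht⟩
  induction M with
  | bot b =>
    intro b m f h
    cases h with
    | bag h _ => cases h
  | var x =>
    have : ∀ {m : Res} (f : ℕ → ℕ), ApproxSpine false m ((Tm.var x : Tm B).rename f) →
        ∃ n, n.rename f = m ∧ ApproxSpine false n (.var x : Tm B) := by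
      intro m f h
      cases h
      exact ⟨_, Res.rename_var _ _, .var x⟩
    intro b m f h
    cases b
    · exact this f h
    · cases h with
      | bag _ h => exact bag _ f _ (.var x) fun v hv => this f (h v hv)
  | lam M ih =>
    have : ∀ {m : Res} (f : ℕ → ℕ), ApproxSpine false m (M.lam.rename f) →
        ∃ n, n.rename f = m ∧ ApproxSpine false n M.lam := by
      intro m f h
      cases h with
      | lam h =>
        obtain ⟨n, rfl, h'⟩ := ih _ h
        exact ⟨_, Res.rename_lam _ _, .lam h'⟩
    intro b m f h
    cases b
    · exact this f h
    · cases h with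
      | bag _ h => exact bag _ f _ (.lam M) fun v hv => this f (h v hv)
  | app M N ihM ihN =>
    intro b m f h
    cases h with
    | bag h _ => cases h
    | appDer h h1 h2 =>
      obtain ⟨m, rfl, h1'⟩ := ihM _ h1
      obtain ⟨n, rfl, h2'⟩ := ihN _ h2
      exact ⟨.app (.der m) n, by simp, .appDer (by simpa using h) h1' h2'⟩
    | appSpine h1 h2 =>
      obtain ⟨m, rfl, h1'⟩ := ihM _ h1
      obtain ⟨n, rfl, h2'⟩ := ihN _ h2
      exact ⟨.app m n, by simp, .appSpine h1' h2'⟩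
  | es M N ihM ihN =>
    intro b m f h
    cases h with
    | bag h _ => cases h
    | es h1 h2 =>
      obtain ⟨m, rfl, h1'⟩ := ihM _ h1
      obtain ⟨n, rfl, h2'⟩ := ihN _ h2
      exact ⟨.es m n, by simp, .es h1' h2'⟩

/-- The approximations of `L⟨M⟩`. -/
theorem inv_plug (L : List (Tm B)) : ∀ {b : Bool} {m : Res} {M : Tm B},
    ApproxSpine b m (plug L M) →
    ∃ l n, m = .plug l n ∧ l.length = L.length ∧ ApproxSpine b n M ∧
      ∀ {b' : Bool} {q : Res} {Q : Tm B},
        ApproxSpine b' q Q → ApproxSpine b' (.plug l q) (plug L Q) := by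
  induction L using List.reverseRecOn with
  | nil => exact fun h => ⟨[], _, rfl, rfl, h, fun h => h⟩
  | append_singleton L N ih =>
    intro b m M h
    rw [plug_append] at h
    cases h with
    | bag h _ => cases h
    | @es _ m n _ _ h1 h2 =>
      obtain ⟨l, q, rfl, hl, hq, hp⟩ := ih h1
      refine ⟨l ++ [n], q, (Res.plug_append _ _ _).symm, by simp [hl], hq, fun h => ?_⟩
      rw [plug_append, Res.plug_append]
      exact .es (hp h) h2

/-- Every approximation of an instance of `M` is obtained from an approximation of `M` by linear
substitution. -/
theorem exists_linSubst (k : ℕ) (M : Tm B) : ∀ {d : ℕ} {W : Tm B} {σ : ℕ → Tm B} {b : Bool}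
    {r : Res}, InstAt k d W σ → W.IsValue → ApproxSpine b r (M.subst σ) →
    ∃ s m, (∀ v ∈ s, ApproxSpine false v W) ∧ ApproxSpine b m M ∧ LinSubst k d s m r := by
  -- Each element of a bag comes from its own linear substitution; the multisets that they consume
  -- are added up.
  have bag : ∀ {V : Tm B} {d : ℕ} {W : Tm B} {u : Multiset Res}, V.IsValue →
      (∀ v ∈ u, ∃ s m, (∀ v ∈ s, ApproxSpine false v W) ∧ ApproxSpine false m V ∧
        LinSubst k d s m v) →
      ∃ s m, (∀ v ∈ s, ApproxSpine false v W) ∧ ApproxSpine true m V ∧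
        LinSubst k d s m (.bag u) := by
    intro V d W u hV h
    suffices ∃ s t, (∀ v ∈ s, ApproxSpine false v W) ∧ (∀ m ∈ t, ApproxSpine false m V) ∧
        LinSubst k d s (.bag t) (.bag u) by
      obtain ⟨s, t, hs, ht, h⟩ := this
      exact ⟨s, _, hs, .bag hV ht, h⟩
    induction u using Multiset.induction with
    | empty => exact ⟨0, 0, by simp, by simp, .bagNil d⟩
    | cons v u ih =>
      obtain ⟨s, m, hs, hm, h1⟩ := h v (Multiset.mem_cons_self v u)
      obtain ⟨s', t, hs', ht, h2⟩ := ih fun v hv => h v (Multiset.mem_cons_of_mem hv)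
      refine ⟨s + s', m ::ₘ t, fun v hv => ?_, fun v hv => ?_, .bagCons h1 h2⟩
      · exact (Multiset.mem_add.1 hv).elim (hs v) (hs' v)
      · rcases Multiset.mem_cons.1 hv with rfl | hv
        · exact hm
        · exact ht v hv
  -- A value has approximations of both kinds, and those of the `true` kind are bags of the other
  -- kind. Since an instance of a value by values is again a value, only the `false` kind needs a
  -- direct proof.
  have value : ∀ {V : Tm B} {d : ℕ} {W : Tm B} {σ : ℕ → Tm B} {b : Bool} {r : Res},
      V.IsValue → (∀ {r : Res}, ApproxSpine false r (V.subst σ) →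
        ∃ s m, (∀ v ∈ s, ApproxSpine false v W) ∧ ApproxSpine false m V ∧ LinSubst k d s m r) →
      InstAt k d W σ → W.IsValue → ApproxSpine b r (V.subst σ) →
      ∃ s m, (∀ v ∈ s, ApproxSpine false v W) ∧ ApproxSpine b m V ∧ LinSubst k d s m r := by
    intro V d W σ b r hV h hσ hW hr
    cases b
    · exact h hr
    · have := hV.subst (hσ.isValue hW)
      generalize V.subst σ = V' at *
      cases hr with
      | bag _ hr => exact bag hV fun v hv => h (hr v hv)
      | es => cases this
      | appDer => cases this
      | appSpine => cases this
  -- Under a binder the elements approximate the shifted `W`, so they are shifts of approximations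
  -- of `W`, as the binder rules of `LinSubst` demand.
  have shift : ∀ {s : Multiset Res} {W : Tm B},
      (∀ v ∈ s, ApproxSpine false v (W.rename Nat.succ)) →
      ∃ t : Multiset Res, (∀ v ∈ t, ApproxSpine false v W) ∧ t.map (Res.rename Nat.succ) = s :=
    fun h => exists_map_of_forall fun v hv =>
      (inv_rename _ _ (h v hv)).imp fun _ h => ⟨h.2, h.1⟩
  induction M with
  | bot b =>
    intro d W σ b r hσ hW h
    cases h with
    | bag h _ => cases h
  | var x =>
    intro d W σ b r hσ hW h
    refine value (.var x) (fun {r} h => ?_) hσ hW h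
    change ApproxSpine false r (σ x) at h
    rcases hσ.cases x with ⟨hx, h'⟩ | ⟨rfl, h'⟩ | ⟨y, hy, rfl, h'⟩ <;> rw [h'] at h
    · cases h
      exact ⟨0, _, by simp, .var x, .lt hx⟩
    · refine ⟨{r}, _, fun v hv => ?_, .var x, .hit x r⟩
      rwa [Multiset.mem_singleton.1 hv]
    · cases h
      exact ⟨0, _, by simp, .var _, .gt hy⟩
  | lam M ih =>
    intro d W σ b r hσ hW h
    refine value (.lam M) (fun {r} h => ?_) hσ hW h
    cases h with
    | lam h =>
      obtain ⟨s, m, hs, hm, hl⟩ := ih hσ.lift (hW.rename _) h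
      obtain ⟨t, ht, rfl⟩ := shift hs
      exact ⟨t, _, ht, .lam hm, .lam hl⟩
  | app M N ihM ihN =>
    intro d W σ b r hσ hW h
    cases h with
    | bag h _ => cases h
    | appDer h h1 h2 =>
      obtain ⟨s, m, hs, hm, hl⟩ := ihM hσ hW h1
      obtain ⟨s', n, hs', hn, hl'⟩ := ihN hσ hW h2
      rw [isAnswer_subst _ _ (hσ.isValue hW)] at h
      exact ⟨s + s', _, fun v hv => (Multiset.mem_add.1 hv).elim (hs v) (hs' v),
        .appDer h hm hn, .app (.der hl) hl'⟩
    | appSpine h1 h2 =>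
      obtain ⟨s, m, hs, hm, hl⟩ := ihM hσ hW h1
      obtain ⟨s', n, hs', hn, hl'⟩ := ihN hσ hW h2
      exact ⟨s + s', _, fun v hv => (Multiset.mem_add.1 hv).elim (hs v) (hs' v),
        .appSpine hm hn, .app hl hl'⟩
  | es M N ihM ihN =>
    intro d W σ b r hσ hW h
    cases h with
    | bag h _ => cases h
    | es h1 h2 =>
      obtain ⟨s, m, hs, hm, hl⟩ := ihM hσ.lift (hW.rename _) h1
      obtain ⟨t, ht, rfl⟩ := shift hs
      obtain ⟨s', n, hs', hn, hl'⟩ := ihN hσ hW h2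
      exact ⟨t + s', _, fun v hv => (Multiset.mem_add.1 hv).elim (ht v) (hs' v),
        .es hm hn, .es hl hl'⟩

end ApproxSpine

/-- Answers remain answers, so the contrapositive carries the side condition of the `der` rule
backwards along a step. -/
theorem StepV.isAnswer {M M' : Term} (h : StepV M M') (hM : M.IsAnswer) : M'.IsAnswer := by
  induction h with
  | beta => simp at hM
  | subst L M V hV =>
    rw [isAnswer_es] at hM
    rw [isAnswer_plug]
    refine (isAnswer_subst _ _ fun x => ?_).2 hM
    cases x
    · exact hV
    · constructor
  | lam => simp
  | appL => simp at hM
  | appR => simp at hM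
  | esL _ _ ih => simpa using ih (by simpa using hM)
  | esR => simpa using hM

/-- Approximations can be pulled back along a reduction step. -/
theorem ApproxSpine.of_stepV {M M' : Term} (h : StepV M M') : ∀ {b : Bool} {m' : Res},
    ApproxSpine b m' M' → (b = false → M.IsAnswer) → ∃ m, ApproxSpine b m M ∧ StepsR m m' := by
  induction h with
  | beta L M N =>
    intro b r h hb
    cases b
    -- The condition attached to `b = false` excludes terms that become answers only through the
    -- step: these have no approximation `l⟨v⟩` to pull back to.
    · simpa using hb rfl
    · obtain ⟨l, q, rfl, hl, hq, hp⟩ := inv_plug L h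
      cases hq with
      | bag h _ => cases h
      | es h1 h2 =>
        obtain ⟨n, rfl, h2'⟩ := inv_rename _ _ h2
        refine ⟨_, .appSpine (hp (.lam h1)) h2', .single ?_⟩
        rw [← hl]
        exact .beta l _ _
  | subst L M V hV =>
    intro b r h _
    obtain ⟨l, q, rfl, hl, hq, hp⟩ := inv_plug L h
    obtain ⟨s, m, hs, hm, hlin⟩ := exists_linSubst L.length M (d := 0) (W := V)
      ⟨fun x hx => by omega, rfl, fun x _ => rfl⟩ hV hq
    refine ⟨_, .es hm (hp (.bag hV hs)), .single ?_⟩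
    rw [← hl] at hlin
    exact .subst l s m q hlin
  | @lam M M' _ ih =>
    have : ∀ m', ApproxSpine false m' M'.lam → ∃ m, ApproxSpine false m M.lam ∧ StepsR m m' := by
      intro m' h
      cases h with
      | lam h =>
        obtain ⟨m, hm, hs⟩ := ih h (by simp)
        exact ⟨_, .lam hm, hs.lam⟩
    intro b m' h _
    cases b
    · exact this _ h
    · cases h with
      | bag _ h =>
        obtain ⟨s, hs, hr⟩ := exists_rel_of_forall fun v hv => this v (h v hv)
        exact ⟨_, .bag (.lam M) hs, .bag hr⟩
  | @appL M M' N hstep ih =>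
    intro b r h hb
    cases h with
    | bag h _ => cases h
    | appDer ha h1 h2 =>
      obtain ⟨m, hm, hs⟩ := ih h1 (by simp)
      exact ⟨_, .appDer (fun h => ha (hstep.isAnswer h)) hm h2, hs.der.app .refl⟩
    | appSpine h1 h2 =>
      by_cases ha : M.IsAnswer
      · obtain ⟨m, hm, hs⟩ := ih h1 fun _ => ha
        exact ⟨_, .appSpine hm h2, hs.app .refl⟩
      -- Here the step has just turned `M` into an answer. Before the step the application is
      -- approximated through a dereliction, and the extra resource step from `der (l⟨[q]⟩)` to
      -- `l⟨q⟩` recovers the given approximation.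
      · obtain ⟨l, q, rfl, h⟩ := (approxV_aux _).2 _ h1
        obtain ⟨m, hm, hs⟩ := ih (of_approxV h) (by simp)
        have hs' : StepsR (.der m) (.plug l q) := Relation.ReflTransGen.tail hs.der (.derBag l q)
        exact ⟨_, .appDer ha hm h2, hs'.app .refl⟩
  | appR M _ ih =>
    intro b r h hb
    cases h with
    | bag h _ => cases h
    | appDer ha h1 h2 =>
      obtain ⟨n, hn, hs⟩ := ih h2 (by simp)
      exact ⟨_, .appDer ha h1 hn, .app .refl hs⟩
    | appSpine h1 h2 =>
      obtain ⟨n, hn, hs⟩ := ih h2 (by simp)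
      exact ⟨_, .appSpine h1 hn, .app .refl hs⟩
  | esL N _ ih =>
    intro b r h hb
    cases h with
    | bag h _ => cases h
    | es h1 h2 =>
      obtain ⟨m, hm, hs⟩ := ih h1 fun h => by simpa using hb h
      exact ⟨_, .es hm h2, .es hs .refl⟩
  | esR M _ ih =>
    intro b r h hb
    cases h with
    | bag h _ => cases h
    | es h1 h2 =>
      obtain ⟨n, hn, hs⟩ := ih h2 (by simp)
      exact ⟨_, .es h1 hn, .es .refl hs⟩

theorem ApproxSpine.of_stepsV {M M' : Term} (h : Relation.ReflTransGen StepV M M') :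
    ∀ {m' : Res}, ApproxSpine true m' M' → ∃ m, ApproxSpine true m M ∧ StepsR m m' := by
  induction h using Relation.ReflTransGen.head_induction_on with
  | refl => exact fun h => ⟨_, h, .refl⟩
  | head h _ ih =>
    intro m' h'
    obtain ⟨m, hm, hs⟩ := ih h'
    obtain ⟨n, hn, hs'⟩ := of_stepV h hm (by simp)
    exact ⟨n, hn, hs'.trans hs⟩

/-! ### Approximations of dCBV approximants -/

theorem ApproxSpine.of_le {A : PTerm} {M : Term} (h : Le A M) :
    ∀ {b : Bool} {m : Res}, ApproxSpine b m A → ApproxSpine b m M := by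
  induction h with
  | bot M =>
    intro b m h
    cases h with
    | bag h _ => cases h
  | var x =>
    intro b m h
    cases h with
    | bag _ h => exact .bag (.var x) fun v hv => by cases h v hv; exact .var x
    | var => exact .var x
  | @lam A M _ ih =>
    intro b m h
    cases h with
    | bag _ h =>
      refine .bag (.lam M) fun v hv => ?_
      cases h v hv with
      | lam h => exact .lam (ih h)
    | lam h => exact .lam (ih h)
  | app _ _ ih ih' =>
    intro b m h
    cases h with
    | bag h _ => cases h
    | appDer ha h1 h2 =>
      -- `A` may fail to be an answer only because `⊥` hides a value of `M`. This cannot happen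
      -- here, since one resource term approximates both.
      refine .appDer (fun h => ha ?_) (ih h1) (ih' h2)
      rwa [← h1.bagSpine_iff, (ih h1).bagSpine_iff]
    | appSpine h1 h2 => exact .appSpine (ih h1) (ih' h2)
  | es _ _ ih ih' =>
    intro b m h
    cases h with
    | bag h _ => cases h
    | es h1 h2 => exact .es (ih h1) (ih' h2)

theorem NonValueV.nonLamV (A : PTerm) (h : NonValueV A) : NonLamV A := by
  induction A with
  | bot => cases h
  | var => cases h
  | lam => cases h
  | app => cases h with | app h h' => exact .app h h'
  | es _ _ ih _ => cases h with | es h h' => exact .es (ih h) h'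

theorem NonValueV.not_isAnswer (A : PTerm) (h : NonValueV A) : ¬ A.IsAnswer := by
  induction A with
  | bot => cases h
  | var => cases h
  | lam => cases h
  | app => simp
  | es _ _ ih _ => cases h with | es h _ => simpa using ih h

theorem NonLamV.not_lamSpine {A : PTerm} : NonLamV A → ∀ {m : Res}, ApproxSpine false m A →
    ¬ m.LamSpine := by
  induction A with
  | bot => intro h; cases h
  | var =>
    intro _ m h
    cases h
    exact Res.not_lamSpine_var _
  | lam => intro h; cases h
  | app => intro _ m h; cases h
  | es _ _ ih _ =>
    intro h m hm
    cases h with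
    | es h _ => cases hm with | es h1 _ => simpa using ih h h1

/-- The grammar excludes each kind of redex: function parts are never abstractions under a list
context, and arguments of explicit substitutions are never answers. The second statement concerns
function positions, where the approximation is a term `l⟨v⟩` and not a bag. -/
theorem ApproximantV.approx_isNormal (A : PTerm) :
    (ApproximantV A → ∀ {m : Res}, ApproxSpine true m A → m.IsNormal) ∧
    (NonLamV A → ∀ {m : Res}, ApproxSpine false m A → m.IsNormal) := by
  induction A with
  | bot =>
    refine ⟨fun _ m h => ?_, fun h => by cases h⟩
    cases h with
    | bag h _ => cases h
  | var x =>
    refine ⟨fun _ m h => ?_, fun _ m h => ?_⟩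
    · cases h with
      | bag _ h =>
        refine Res.isNormal_bag.2 fun v hv => ?_
        cases h v hv
        exact Res.isNormal_var x
    · cases h
      exact Res.isNormal_var x
  | lam A ih =>
    refine ⟨fun hA m h => ?_, fun h => by cases h⟩
    cases hA with
    | nonLam h => cases h
    | lam hA =>
      cases h with
      | bag _ h =>
        refine Res.isNormal_bag.2 fun v hv => ?_
        cases h v hv with
        | lam h => exact Res.isNormal_lam.2 (ih.1 hA h)
  | app A A' ih ih' =>
    refine ⟨fun hA m h => ?_, fun _ m h => by cases h⟩
    cases hA with
    | nonLam hA =>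
      cases hA with
      | app hA hA' =>
        cases h with
        | bag h _ => cases h
        | appDer ha h1 h2 =>
          rw [← h1.bagSpine_iff] at ha
          exact Res.isNormal_app.2 ⟨Res.not_lamSpine_der _,
            Res.isNormal_der.2 ⟨ha, ih.1 (.nonLam hA) h1⟩, ih'.1 hA' h2⟩
        | appSpine h1 h2 =>
          exact Res.isNormal_app.2 ⟨hA.not_lamSpine h1, ih.2 hA h1, ih'.1 hA' h2⟩
  | es A A' ih ih' =>
    have main : NonValueV A' → ∀ {n : Res}, ApproxSpine true n A' → ¬ n.BagSpine ∧ n.IsNormal :=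
      fun h n hn => ⟨hn.bagSpine_iff.not.2 (NonValueV.not_isAnswer _ h),
        ih'.1 (.nonLam (NonValueV.nonLamV _ h)) hn⟩
    refine ⟨fun hA m h => ?_, fun hA m h => ?_⟩
    · obtain ⟨hA, hA'⟩ : ApproximantV A ∧ NonValueV A' := by
        cases hA with
        | nonLam hA => cases hA with | es hA hA' => exact ⟨.nonLam hA, hA'⟩
        | es hA hA' => exact ⟨hA, hA'⟩
      cases h with
      | bag h _ => cases h
      | es h1 h2 => exact Res.isNormal_es.2 ⟨(main hA' h2).1, ih.1 hA h1, (main hA' h2).2⟩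
    · cases hA with
      | es hA hA' =>
        cases h with
        | es h1 h2 => exact Res.isNormal_es.2 ⟨(main hA' h2).1, ih.2 hA h1, (main hA' h2).2⟩

/-- An approximant that is not an answer has `⊥` or an application under its list context. Having an
approximation rules out `⊥`. -/
theorem ApproximantV.nonValueV {A : PTerm} : ApproximantV A → ¬ A.IsAnswer →
    ∀ {m : Res}, ApproxSpine true m A → NonValueV A := by
  induction A with
  | bot =>
    intro _ _ m h
    cases h with
    | bag h _ => cases h
  | var => intro _ h; simp at h
  | lam => intro _ h; simp at h
  | app =>
    intro h _ _ _
    cases h with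
    | nonLam h => cases h with | app h h' => exact .app h h'
  | es A A' ih _ =>
    intro hA ha m h
    obtain ⟨hA, hA'⟩ : ApproximantV A ∧ NonValueV A' := by
      cases hA with
      | nonLam hA => cases hA with | es hA hA' => exact ⟨.nonLam hA, hA'⟩
      | es hA hA' => exact ⟨hA, hA'⟩
    cases h with
    | bag h _ => cases h
    | es h1 _ => exact .es (ih hA (by simpa using ha) h1) hA'

/-- A spine approximation exists only over a variable or an abstraction, and the second would show
up in `m` as an abstraction under a list context. -/
theorem ApproximantV.nonLamV {A : PTerm} : ApproximantV A →
    ∀ {m : Res}, ApproxSpine false m A → ¬ m.LamSpine → NonLamV A := by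
  induction A with
  | bot => intro _ m h; cases h
  | var => intro _ _ _ _; exact .var _
  | lam =>
    intro _ m h hm
    cases h
    exact (hm (Res.lamSpine_lam _)).elim
  | app => intro _ m h; cases h
  | es A A' ih _ =>
    intro hA m h hm
    obtain ⟨hA, hA'⟩ : ApproximantV A ∧ NonValueV A' := by
      cases hA with
      | nonLam hA => cases hA with | es hA hA' => exact ⟨.nonLam hA, hA'⟩
      | es hA hA' => exact ⟨hA, hA'⟩
    cases h with
    | es h1 _ => exact .es (ih hA h1 (by simpa using hm)) hA'

/-- The largest dCBV approximant of a term has all its normal approximations. -/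
theorem exists_approximantV (N : Term) : ∃ A : PTerm, ApproximantV A ∧ Le A N ∧
    ∀ {b : Bool} {p : Res}, ApproxSpine b p N → p.IsNormal → ApproxSpine b p A := by
  induction N with
  | bot b => exact b.elim
  | var x =>
    refine ⟨.var x, .nonLam (.var x), .var x, fun h _ => ?_⟩
    cases h with
    | bag _ h => exact .bag (.var x) fun v hv => by cases h v hv; exact .var x
    | var => exact .var x
  | lam N ih =>
    obtain ⟨A, hA, hle, h⟩ := ih
    refine ⟨.lam A, .lam hA, .lam hle, fun hp hn => ?_⟩
    cases hp with
    | bag _ hp =>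
      refine .bag (.lam A) fun v hv => ?_
      have := Res.isNormal_bag.1 hn v hv
      cases hp v hv with
      | lam hp => exact .lam (h hp (Res.isNormal_lam.1 this))
    | lam hp => exact .lam (h hp (Res.isNormal_lam.1 hn))
  | app M N ihM ihN =>
    obtain ⟨A, hA, hle, h⟩ := ihM
    obtain ⟨A', hA', hle', h'⟩ := ihN
    -- A single normal approximation already forces the application to be kept. When `A` is not of
    -- the required form there is thus no normal approximation, and `⊥` loses nothing.
    have key : ∀ {b : Bool} {p : Res}, ApproxSpine b p (.app M N) → p.IsNormal →
        NonLamV A ∧ ApproxSpine b p (.app A A') := by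
      intro b p hp hn
      cases hp with
      | bag h _ => cases h
      | appDer ha h1 h2 =>
        obtain ⟨-, hm, hn⟩ := Res.isNormal_app.1 hn
        have := h h1 (Res.isNormal_der.1 hm).2
        rw [← h1.bagSpine_iff, this.bagSpine_iff] at ha
        exact ⟨NonValueV.nonLamV _ (hA.nonValueV ha this), .appDer ha this (h' h2 hn)⟩
      | appSpine h1 h2 =>
        obtain ⟨hl, hm, hn⟩ := Res.isNormal_app.1 hn
        exact ⟨hA.nonLamV (h h1 hm) hl, .appSpine (h h1 hm) (h' h2 hn)⟩
    by_cases hL : NonLamV A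
    · exact ⟨.app A A', .nonLam (.app hL hA'), .app hle hle', fun hp hn => (key hp hn).2⟩
    · exact ⟨PTerm.bottom, .bot, .bot _, fun hp hn => (hL (key hp hn).1).elim⟩
  | es M N ihM ihN =>
    obtain ⟨A, hA, hle, h⟩ := ihM
    obtain ⟨A', hA', hle', h'⟩ := ihN
    have key : ∀ {b : Bool} {p : Res}, ApproxSpine b p (.es M N) → p.IsNormal →
        NonValueV A' ∧ ApproxSpine b p (.es A A') := by
      intro b p hp hn
      cases hp with
      | bag h _ => cases h
      | es h1 h2 =>
        obtain ⟨hb, hm, hn⟩ := Res.isNormal_es.1 hn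
        have := h' h2 hn
        exact ⟨hA'.nonValueV (this.bagSpine_iff.not.1 hb) this, .es (h h1 hm) this⟩
    by_cases hL : NonValueV A'
    · exact ⟨.es A A', .es hA hL, .es hle hle', fun hp hn => (key hp hn).2⟩
    · exact ⟨PTerm.bottom, .bot, .bot _, fun hp hn => (hL (key hp hn).1).elim⟩

-- Stability of normal dCBV approximations under reduction

theorem ApproxSpine.lamSpine {B : Type} {M N R : Tm B} (hb : Beta M N R) :
    ∀ {m : Res}, ApproxSpine false m M → m.LamSpine := by
  induction hb with
  | lam => intro m h; cases h; exact Res.lamSpine_lam _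
  | es _ _ ih => intro m h; cases h with | es h1 _ => simpa using ih h1

/-- Normal approximations are preserved by reduction. -/
theorem ApproxSpine.step {N N' : Term} (h : Step true N N') : ∀ {b : Bool} {p : Res},
    ApproxSpine b p N → p.IsNormal → ApproxSpine b p N' := by
  induction h with
  | beta hb =>
    intro b p h hn
    cases h with
    | bag h _ => cases h
    | appDer ha _ _ => exact (ha hb.isAnswer).elim
    | appSpine h1 _ =>
      exact ((Res.isNormal_app.1 hn).1 (h1.lamSpine hb)).elim
  | sub hs =>
    intro b p h hn
    cases h with
    | bag h _ => cases h
    -- An explicit substitution that can fire has an answer as its argument, so the approximation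
    -- would contain the corresponding resource redex.
    | es _ h2 => exact ((Res.isNormal_es.1 hn).1 (h2.bagSpine_iff.2 hs.isAnswer)).elim
  | @lam M M' _ ih =>
    intro b p h hn
    cases h with
    | bag _ h =>
      refine .bag (.lam M') fun v hv => ?_
      have := Res.isNormal_bag.1 hn v hv
      cases h v hv with
      | lam h => exact .lam (ih h (Res.isNormal_lam.1 this))
    | lam h => exact .lam (ih h (Res.isNormal_lam.1 hn))
  | appL N _ ih =>
    intro b p h hn
    cases h with
    | bag h _ => cases h
    | appDer ha h1 h2 =>
      obtain ⟨hb, hm⟩ := Res.isNormal_der.1 (Res.isNormal_app.1 hn).2.1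
      have := ih h1 hm
      exact .appDer (this.bagSpine_iff.not.1 hb) this h2
    | appSpine h1 h2 => exact .appSpine (ih h1 (Res.isNormal_app.1 hn).2.1) h2
  | appR M _ ih =>
    intro b p h hn
    cases h with
    | bag h _ => cases h
    | appDer ha h1 h2 => exact .appDer ha h1 (ih h2 (Res.isNormal_app.1 hn).2.2)
    | appSpine h1 h2 => exact .appSpine h1 (ih h2 (Res.isNormal_app.1 hn).2.2)
  | esL N _ ih =>
    intro b p h hn
    cases h with
    | bag h _ => cases h
    | es h1 h2 => exact .es (ih h1 (Res.isNormal_es.1 hn).2.1) h2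
  | esR M _ ih =>
    intro b p h hn
    cases h with
    | bag h _ => cases h
    | es h1 h2 => exact .es h1 (ih h2 (Res.isNormal_es.1 hn).2.2)

theorem ApproxSpine.steps {N N' : Term} (h : Steps true N N') {b : Bool} {p : Res}
    (hp : ApproxSpine b p N) (hn : p.IsNormal) : ApproxSpine b p N' := by
  induction h with
  | refl => exact hp
  | tail _ h ih => exact ih.step h hn

/-! ### Approximation up to reduction -/

/-- The syntactic roles of resource terms in dCBV approximations: arguments, terms `l⟨v⟩` in
function position, all terms in function position, and bags of approximations of a value. -/
inductive Mode : Type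
  | arg | spine | head | elems

/-- dCBV resource approximation where the approximated term may be reduced at every node, in
different ways for the different elements of a bag. -/
inductive EvApproxV : Mode → Res → Term → Prop
  | var {M : Term} {x : ℕ} : Steps true M (.var x) → EvApproxV .spine (.var x) M
  | lam {M M' : Term} {m : Res} : Steps true M (.lam M') → EvApproxV .arg m M' →
      EvApproxV .spine (.lam m) M
  | esArg {M M' N : Term} {m n : Res} : Steps true M (.es M' N) → EvApproxV .arg m M' →
      EvApproxV .arg n N → EvApproxV .arg (.es m n) M
  | esSpine {M M' N : Term} {m n : Res} : Steps true M (.es M' N) → EvApproxV .spine m M' →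
      EvApproxV .arg n N → EvApproxV .spine (.es m n) M
  | bag {M V : Term} {s : Multiset Res} : Steps true M V → V.IsValue →
      EvApproxV .elems (.bag s) V → EvApproxV .arg (.bag s) M
  | elems {M : Term} {s : Multiset Res} : (∀ v ∈ s, EvApproxV .spine v M) →
      EvApproxV .elems (.bag s) M
  | der {M : Term} {m : Res} : EvApproxV .arg m M → EvApproxV .head (.der m) M
  | spine {M : Term} {m : Res} : EvApproxV .spine m M → EvApproxV .head m M
  | app {M M' N : Term} {m n : Res} : Steps true M (.app M' N) → EvApproxV .head m M' →
      EvApproxV .arg n N → EvApproxV .arg (.app m n) M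

namespace EvApproxV

/-- A preliminary reduction of the approximated term is absorbed by the reductions allowed at the
nodes; for a bag in mode `elems` it is absorbed by every element separately. -/
theorem of_steps {b : Mode} {m : Res} {M M' : Term} (hs : Steps true M M')
    (h : EvApproxV b m M') : EvApproxV b m M := by
  induction h with
  | var h => exact .var (hs.trans h)
  | lam h h1 => exact .lam (hs.trans h) h1
  | esArg h h1 h2 => exact .esArg (hs.trans h) h1 h2
  | esSpine h h1 h2 => exact .esSpine (hs.trans h) h1 h2
  | bag h hV h1 => exact .bag (hs.trans h) hV h1
  | elems _ ih => exact .elems fun v hv => ih v hv hs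
  | der _ ih => exact .der (ih hs)
  | spine _ ih => exact .spine (ih hs)
  | app h h1 h2 => exact .app (hs.trans h) h1 h2

theorem rename {b : Mode} {m : Res} {M : Term} (h : EvApproxV b m M) :
    ∀ f : ℕ → ℕ, EvApproxV b (m.rename f) (M.rename f) := by
  induction h with
  | var h => intro f; rw [Res.rename_var]; exact .var (h.rename f)
  | lam h _ ih => intro f; rw [Res.rename_lam]; exact .lam (h.rename f) (ih _)
  | esArg h _ _ ih ih' => intro f; rw [Res.rename_es]; exact .esArg (h.rename f) (ih _) (ih' _)
  | esSpine h _ _ ih ih' =>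
    intro f; rw [Res.rename_es]; exact .esSpine (h.rename f) (ih _) (ih' _)
  | bag h hV _ ih =>
    intro f
    have := ih f
    rw [Res.rename_bag] at this ⊢
    exact .bag (h.rename f) (hV.rename f) this
  | elems _ ih =>
    intro f
    rw [Res.rename_bag]
    refine .elems fun v hv => ?_
    obtain ⟨m, hm, rfl⟩ := Multiset.mem_map.1 hv
    exact ih m hm f
  | der _ ih => intro f; rw [Res.rename_der]; exact .der (ih f)
  | spine _ ih => exact fun f => .spine (ih f)
  | app h _ _ ih ih' => intro f; rw [Res.rename_app]; exact .app (h.rename f) (ih f) (ih' f)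

theorem of_approxSpine {b : Bool} {m : Res} {M : Term} (h : ApproxSpine b m M) :
    EvApproxV (if b then .arg else .spine) m M := by
  induction h with
  | var x => exact .var .refl
  | lam _ ih => exact .lam .refl ih
  | @es b _ _ _ _ _ _ ih ih' =>
    cases b
    · exact .esSpine .refl ih ih'
    · exact .esArg .refl ih ih'
  | bag hV _ ih => exact .bag .refl hV (.elems ih)
  | appDer _ _ _ ih ih' => exact .app .refl (.der ih) ih'
  | appSpine _ _ ih ih' => exact .app .refl (.spine ih) ih'

theorem inv_head {m : Res} {M : Term} (h : EvApproxV .head m M) :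
    (∃ n, m = .der n ∧ EvApproxV .arg n M) ∨ EvApproxV .spine m M := by
  cases h with
  | der h => exact .inl ⟨_, rfl, h⟩
  | spine h => exact .inr h

/-- Embedding of the role `l⟨v⟩` into the other roles that admit it. -/
theorem of_spine {b : Mode} {m : Res} {M : Term} (hb : b = .spine ∨ b = .head)
    (h : EvApproxV .spine m M) : EvApproxV b m M := by
  rcases hb with rfl | rfl
  · exact h
  · exact .spine h

theorem inv_var {b : Mode} {x : ℕ} {M : Term} (h : EvApproxV b (.var x) M) :
    (b = .spine ∨ b = .head) ∧ Steps true M (.var x) := by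
  generalize e : Res.var x = q at h
  have e' := congrArg Res.view e
  -- Induction and not mere case analysis: the rule `spine` changes the mode from `spine` to `head`
  -- while keeping the same resource term.
  induction h <;> simp at e'
  case var h => exact ⟨.inl rfl, e' ▸ h⟩
  case spine ih => exact ⟨.inr rfl, (ih e (congrArg _ e)).2⟩

theorem inv_lam {b : Mode} {m : Res} {M : Term} (h : EvApproxV b (.lam m) M) :
    (b = .spine ∨ b = .head) ∧ ∃ M', Steps true M (.lam M') ∧ EvApproxV .arg m M' := by
  generalize e : Res.lam m = q at h
  have e' := congrArg Res.view e
  induction h <;> simp at e'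
  case lam h h1 _ => exact ⟨.inl rfl, _, h, e' ▸ h1⟩
  case spine ih => exact ⟨.inr rfl, (ih e (congrArg _ e)).2⟩

theorem inv_app {b : Mode} {m n : Res} {M : Term} (h : EvApproxV b (.app m n) M) :
    b = .arg ∧ ∃ M' N, Steps true M (.app M' N) ∧ EvApproxV .head m M' ∧ EvApproxV .arg n N := by
  generalize e : Res.app m n = q at h
  have e' := congrArg Res.view e
  induction h <;> simp at e'
  case app h h1 h2 _ _ => exact ⟨rfl, _, _, h, e'.1 ▸ h1, e'.2 ▸ h2⟩
  case spine ih => exact absurd (ih e (congrArg _ e)).1 (by simp)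

theorem inv_es {b : Mode} {m n : Res} {M : Term} (h : EvApproxV b (.es m n) M) :
    ∃ c, (c = .arg ∧ b = .arg ∨ c = .spine ∧ (b = .spine ∨ b = .head)) ∧
      ∃ M' N, Steps true M (.es M' N) ∧ EvApproxV c m M' ∧ EvApproxV .arg n N := by
  generalize e : Res.es m n = q at h
  have e' := congrArg Res.view e
  induction h <;> simp at e'
  case esArg h h1 h2 _ _ =>
    exact ⟨_, .inl ⟨rfl, rfl⟩, _, _, h, e'.1 ▸ h1, e'.2 ▸ h2⟩
  case esSpine h h1 h2 _ _ =>
    exact ⟨_, .inr ⟨rfl, .inl rfl⟩, _, _, h, e'.1 ▸ h1, e'.2 ▸ h2⟩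
  case spine ih =>
    obtain ⟨c, hc, h⟩ := ih e (congrArg _ e)
    exact ⟨c, by simpa using hc, h⟩

theorem es {b c : Mode} {m n : Res} {M M' N : Term}
    (hc : c = .arg ∧ b = .arg ∨ c = .spine ∧ (b = .spine ∨ b = .head))
    (h : Steps true M (.es M' N)) (h1 : EvApproxV c m M') (h2 : EvApproxV .arg n N) :
    EvApproxV b (.es m n) M := by
  rcases hc with ⟨rfl, rfl⟩ | ⟨rfl, hb⟩
  · exact .esArg h h1 h2
  · exact of_spine hb (.esSpine h h1 h2)

theorem inv_der {b : Mode} {m : Res} {M : Term} (h : EvApproxV b (.der m) M) :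
    b = .head ∧ EvApproxV .arg m M := by
  generalize e : Res.der m = q at h
  have e' := congrArg Res.view e
  induction h <;> simp at e'
  case der h _ => exact ⟨rfl, e' ▸ h⟩
  case spine ih => exact absurd (ih e (congrArg _ e)).1 (by simp)

theorem inv_elems {s : Multiset Res} {M : Term} (h : EvApproxV .elems (.bag s) M) :
    ∀ v ∈ s, EvApproxV .spine v M := by
  generalize e : Res.bag s = q at h
  cases h with
  | elems h => exact Res.bag_injective e ▸ h

theorem inv_bag {b : Mode} {s : Multiset Res} {M : Term} (h : EvApproxV b (.bag s) M) :
    b = .elems ∨ b = .arg ∧ ∃ V, Steps true M V ∧ V.IsValue ∧ EvApproxV .elems (.bag s) V := by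
  generalize e : Res.bag s = q at h
  have e' := congrArg Res.view e
  induction h <;> simp at e'
  case bag h hV h1 _ => exact .inr ⟨rfl, _, h, hV, e' ▸ h1⟩
  case elems => exact .inl rfl
  case spine ih => exact absurd (ih e (congrArg _ e)) (by simp)

theorem inv_arg_bag {s : Multiset Res} {M : Term} (h : EvApproxV .arg (.bag s) M) :
    ∃ V, Steps true M V ∧ V.IsValue ∧ EvApproxV .elems (.bag s) V := by
  rcases h.inv_bag with h | h
  · cases h
  · exact h.2

end EvApproxV

-- Invariance under resource reduction, and the case of normal terms

namespace EvApproxV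

/-- The entries of `l` are nested on the left, so the reductions made at the successive explicit
substitutions combine into one reduction to a term `L⟨M'⟩`. The last clause allows the term in the
hole to be exchanged. -/
theorem inv_plug (l : List Res) : ∀ {b : Mode} {m : Res} {M : Term}, b = .arg ∨ b = .spine →
    EvApproxV b (.plug l m) M → ∃ L M', L.length = l.length ∧ Steps true M (plug L M') ∧
      EvApproxV b m M' ∧ ∀ {b : Mode} {q : Res} {Q : Term}, b = .arg ∨ b = .spine →
        EvApproxV b q Q → EvApproxV b (.plug l q) (plug L Q) := by
  induction l using List.reverseRecOn with
  | nil => exact fun _ h => ⟨[], _, rfl, .refl, h, fun _ h => h⟩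
  | append_singleton l n ih =>
    intro b m M hb h
    rw [Res.plug_append] at h
    obtain ⟨c, hc, M', N, hs, h1, h2⟩ := h.inv_es
    obtain rfl : c = b := by
      rcases hb with rfl | rfl <;> simpa using hc
    obtain ⟨L, Q, hL, hs', hq, hp⟩ := ih hb h1
    refine ⟨L ++ [N], Q, by simp [hL], ?_, hq, fun {b q Q} hb h => ?_⟩
    · rw [plug_append]
      exact hs.trans (hs'.es .refl)
    · rw [plug_append, Res.plug_append]
      exact es (c := b) (by rcases hb with rfl | rfl <;> simp) .refl (hp hb h) h2

/-- Reductions are preserved by substituting a value, so each node keeps its own reduction. At a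
replaced occurrence the approximated term reduces to the variable, hence its instance reduces to
`W`, which the inserted element approximates. Nothing requires the different occurrences to agree on
a reduct. -/
theorem linSubst {k d : ℕ} {s : Multiset Res} {m r : Res} (h : LinSubst k d s m r) :
    ∀ {b : Mode} {M W : Term} {σ : ℕ → Term}, InstAt k d W σ → W.IsValue →
      (∀ v ∈ s, EvApproxV .spine v W) → EvApproxV b m M → EvApproxV b r (M.subst σ) := by
  have shift : ∀ {s : Multiset Res} {W : Term}, (∀ v ∈ s, EvApproxV .spine v W) →
      ∀ v ∈ s.map (Res.rename Nat.succ), EvApproxV .spine v (W.rename Nat.succ) := by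
    intro s W h v hv
    obtain ⟨w, hw, rfl⟩ := Multiset.mem_map.1 hv
    exact (h w hw).rename _
  induction h with
  | hit d n =>
    intro b M W σ hσ hW hs h
    obtain ⟨hb, h⟩ := h.inv_var
    have := h.subst fun _ => hσ.isValue hW
    refine of_spine hb (of_steps this ?_)
    change EvApproxV .spine n (σ d)
    rw [hσ.2.1]
    exact hs n (Multiset.mem_singleton_self n)
  | @lt d x hx =>
    intro b M W σ hσ hW hs h
    obtain ⟨hb, h⟩ := h.inv_var
    have := h.subst fun _ => hσ.isValue hW
    rw [Tm.subst, hσ.1 x hx] at this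
    exact of_spine hb (.var this)
  | @gt d x hx =>
    intro b M W σ hσ hW hs h
    obtain ⟨hb, h⟩ := h.inv_var
    have := h.subst fun _ => hσ.isValue hW
    rw [Tm.subst, hσ.2.2 x hx] at this
    exact of_spine hb (.var this)
  | lam _ ih =>
    intro b M W σ hσ hW hs h
    obtain ⟨hb, M', h, h1⟩ := h.inv_lam
    exact of_spine hb (.lam (h.subst fun _ => hσ.isValue hW)
      (ih hσ.lift (hW.rename _) (shift hs) h1))
  | app _ _ ih ih' =>
    intro b M W σ hσ hW hs h
    obtain ⟨rfl, M', N, h, h1, h2⟩ := h.inv_app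
    exact .app (h.subst fun _ => hσ.isValue hW)
      (ih hσ hW (fun v hv => hs v (Multiset.mem_add.2 (.inl hv))) h1)
      (ih' hσ hW (fun v hv => hs v (Multiset.mem_add.2 (.inr hv))) h2)
  | es _ _ ih ih' =>
    intro b M W σ hσ hW hs h
    obtain ⟨c, hc, M', N, h, h1, h2⟩ := h.inv_es
    exact es hc (h.subst fun _ => hσ.isValue hW)
      (ih hσ.lift (hW.rename _) (shift fun v hv => hs v (Multiset.mem_add.2 (.inl hv))) h1)
      (ih' hσ hW (fun v hv => hs v (Multiset.mem_add.2 (.inr hv))) h2)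
  | der _ ih =>
    intro b M W σ hσ hW hs h
    obtain ⟨rfl, h'⟩ := h.inv_der
    exact .der (ih hσ hW hs h')
  | bagNil d =>
    intro b M W σ hσ hW hs h
    rcases h.inv_bag with rfl | ⟨rfl, V, h, hV, -⟩
    · exact .elems (by simp)
    · exact .bag (h.subst fun _ => hσ.isValue hW) (hV.subst (hσ.isValue hW)) (.elems (by simp))
  | @bagCons d s t m m' u u' _ _ ih ih' =>
    have key : ∀ {M W : Term} {σ : ℕ → Term}, InstAt k d W σ → W.IsValue →
        (∀ v ∈ s + t, EvApproxV .spine v W) → EvApproxV .elems (.bag (m ::ₘ u)) M →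
        EvApproxV .elems (.bag (m' ::ₘ u')) (M.subst σ) := by
      intro M W σ hσ hW hs h
      have h := h.inv_elems
      refine .elems fun v hv => ?_
      rcases Multiset.mem_cons.1 hv with rfl | hv
      · exact ih hσ hW (fun v hv => hs v (Multiset.mem_add.2 (.inl hv)))
          (h _ (Multiset.mem_cons_self _ _))
      · exact (ih' hσ hW (fun v hv => hs v (Multiset.mem_add.2 (.inr hv)))
          (.elems fun v hv => h v (Multiset.mem_cons_of_mem hv))).inv_elems v hv
    intro b M W σ hσ hW hs h
    rcases h.inv_bag with rfl | ⟨rfl, V, h, hV, h1⟩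
    · exact key hσ hW hs h
    · exact .bag (h.subst fun _ => hσ.isValue hW) (hV.subst (hσ.isValue hW)) (key hσ hW hs h1)

/-- A resource step is absorbed by letting the term reduce further at the affected node: β and
substitution steps are matched by the same root step, and a dereliction step by a change from `der`
to a spine in function position. A step inside one element of a bag leaves the other elements
untouched. -/
theorem stepR {m : Res} {o : Option Res} (h : StepR m o) : ∀ {m' : Res}, o = some m' →
    ∀ {b : Mode} {M : Term}, EvApproxV b m M → EvApproxV b m' M := by
  induction h with
  | beta l m n =>
    rintro _ ⟨⟩ b M h
    obtain ⟨rfl, M', N, hs, h1, h2⟩ := h.inv_app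
    rcases h1.inv_head with ⟨q, e, -⟩ | h1
    · exact (Res.not_lamSpine_der q (e ▸ ⟨l, _, ⟨m, rfl⟩, rfl⟩)).elim
    · obtain ⟨L, P, hL, hs', h3, hp⟩ := inv_plug l (.inr rfl) h1
      obtain ⟨-, P', hs'', h3⟩ := h3.inv_lam
      have : Steps true M' (plug L P'.lam) := hs'.trans (hs''.plug L)
      refine of_steps ((hs.trans (this.app .refl)).tail (.beta (beta_plug L P' N)))
        (hp (.inl rfl) (.esArg .refl h3 ?_))
      rw [hL]
      exact h2.rename _
  | subst l s m r hl =>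
    rintro _ ⟨⟩ b M h
    obtain ⟨c, hc, M', N, hs, h1, h2⟩ := h.inv_es
    obtain ⟨L, P, hL, hs', h3, hp⟩ := inv_plug l (.inl rfl) h2
    obtain ⟨V, hs'', hV, h3⟩ := h3.inv_arg_bag
    have h4 : EvApproxV c r (Tm.inst L.length V M') :=
      linSubst hl (d := 0) (W := V) ⟨fun x hx => by omega, rfl, fun x _ => by rw [hL]⟩ hV
        h3.inv_elems h1
    refine of_steps ((hs.trans (Steps.es .refl (hs'.trans (hs''.plug L)))).tail (.sub (sub_plug L hV M'))) ?_
    rcases hc with ⟨rfl, rfl⟩ | ⟨rfl, hb⟩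
    · exact hp (.inl rfl) h4
    · exact of_spine hb (hp (.inr rfl) h4)
  | substEmpty => rintro _ ⟨⟩
  | derBag l m =>
    rintro _ ⟨⟩ b M h
    obtain ⟨rfl, h'⟩ := h.inv_der
    obtain ⟨L, P, hL, hs', h3, hp⟩ := inv_plug l (.inl rfl) h'
    obtain ⟨V, hs'', hV, h3⟩ := h3.inv_arg_bag
    -- The unique element of the bag is a spine approximation of `V`, so the whole becomes a spine
    -- approximation and no longer needs `der`.
    exact .spine (of_steps hs' (hp (.inr rfl)
      (of_steps hs'' (h3.inv_elems m (Multiset.mem_singleton_self m)))))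
  | derEmpty => rintro _ ⟨⟩
  | lam _ ih =>
    intro m' e b M h
    obtain ⟨n, rfl, rfl⟩ := Option.map_eq_some_iff.1 e
    obtain ⟨hb, M', hs, h1⟩ := h.inv_lam
    exact of_spine hb (.lam hs (ih rfl h1))
  | appL _ _ ih =>
    intro m' e b M h
    obtain ⟨n, rfl, rfl⟩ := Option.map_eq_some_iff.1 e
    obtain ⟨rfl, M', N, hs, h1, h2⟩ := h.inv_app
    exact .app hs (ih rfl h1) h2
  | appR _ _ ih =>
    intro m' e b M h
    obtain ⟨n, rfl, rfl⟩ := Option.map_eq_some_iff.1 e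
    obtain ⟨rfl, M', N, hs, h1, h2⟩ := h.inv_app
    exact .app hs h1 (ih rfl h2)
  | esL _ _ ih =>
    intro m' e b M h
    obtain ⟨n, rfl, rfl⟩ := Option.map_eq_some_iff.1 e
    obtain ⟨c, hc, M', N, hs, h1, h2⟩ := h.inv_es
    exact es hc hs (ih rfl h1) h2
  | esR _ _ ih =>
    intro m' e b M h
    obtain ⟨n, rfl, rfl⟩ := Option.map_eq_some_iff.1 e
    obtain ⟨c, hc, M', N, hs, h1, h2⟩ := h.inv_es
    exact es hc hs h1 (ih rfl h2)
  | der _ ih =>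
    intro m' e b M h
    obtain ⟨n, rfl, rfl⟩ := Option.map_eq_some_iff.1 e
    obtain ⟨rfl, h'⟩ := h.inv_der
    exact .der (ih rfl h')
  | @bag m o s _ ih =>
    intro m' e b M h
    obtain ⟨n, rfl, rfl⟩ := Option.map_eq_some_iff.1 e
    have key : ∀ {V : Term}, EvApproxV .elems (.bag (m ::ₘ s)) V →
        EvApproxV .elems (.bag (n ::ₘ s)) V := by
      intro V h
      have h := h.inv_elems
      refine .elems fun v hv => ?_
      rcases Multiset.mem_cons.1 hv with rfl | hv
      · exact ih rfl (h m (Multiset.mem_cons_self _ _))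
      · exact h v (Multiset.mem_cons_of_mem hv)
    rcases h.inv_bag with rfl | ⟨rfl, V, hs, hV, h⟩
    · exact key h
    · exact .bag hs hV (key h)

theorem stepsR {m m' : Res} (h : StepsR m m') {b : Mode} {M : Term} (hm : EvApproxV b m M) :
    EvApproxV b m' M := by
  induction h with
  | refl => exact hm
  | tail _ h ih => exact stepR h rfl ih

/-- The approximation of a reduct that is expressed by an approximation up to reduction, in the
case of a normal resource term. -/
def Realized : Mode → Res → Term → Prop
  | .arg, p, M => ∃ N, Steps true M N ∧ ApproxSpine true p N
  | .spine, p, M => ∃ N, Steps true M N ∧ ApproxSpine false p N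
  | .head, p, M => ∃ N, Steps true M N ∧ ∀ {n : Res} {N' : Term}, ApproxSpine true n N' →
      ApproxSpine true (.app p n) (.app N N')
  | .elems, p, M => M.IsValue → ∃ N, Steps true M N ∧ ApproxSpine true p N

/-- Subterms of a normal term are normal, and reductions at distinct nodes of the approximated term
compose freely. Only a bag shares one term among several elements, and that is where confluence and
stability of normal approximations enter. -/
theorem realized {b : Mode} {p : Res} {M : Term} (h : EvApproxV b p M) :
    p.IsNormal → Realized b p M := by
  induction h with
  | @var _ x h => exact fun _ => ⟨_, h, .var x⟩
  | lam h _ ih =>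
    intro hn
    obtain ⟨N, hs, hN⟩ := ih (Res.isNormal_lam.1 hn)
    exact ⟨_, h.trans hs.lam, .lam hN⟩
  | esArg h _ _ ih ih' =>
    intro hn
    obtain ⟨-, h1, h2⟩ := Res.isNormal_es.1 hn
    obtain ⟨N, hs, hN⟩ := ih h1
    obtain ⟨N', hs', hN'⟩ := ih' h2
    exact ⟨_, h.trans (hs.es hs'), .es hN hN'⟩
  | esSpine h _ _ ih ih' =>
    intro hn
    obtain ⟨-, h1, h2⟩ := Res.isNormal_es.1 hn
    obtain ⟨N, hs, hN⟩ := ih h1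
    obtain ⟨N', hs', hN'⟩ := ih' h2
    exact ⟨_, h.trans (hs.es hs'), .es hN hN'⟩
  | bag h hV _ ih =>
    intro hn
    obtain ⟨N, hs, hN⟩ := ih hn hV
    exact ⟨_, h.trans hs, hN⟩
  | @elems M s h ih =>
    intro hn hV
    clear h
    replace hn := Res.isNormal_bag.1 hn
    suffices ∃ N, Steps true M N ∧ ∀ v ∈ s, ApproxSpine false v N by
      obtain ⟨N, hs, hN⟩ := this
      exact ⟨N, hs, .bag (hs.isValue hV) hN⟩
    replace ih : ∀ v ∈ s, ∃ N, Steps true M N ∧ ApproxSpine false v N :=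
      fun v hv => ih v hv (hn v hv)
    induction s using Multiset.induction with
    | empty => exact ⟨M, .refl, by simp⟩
    | cons v s ihs =>
      obtain ⟨N, hs, hN⟩ := ihs
        (fun v hv => hn v (Multiset.mem_cons_of_mem hv))
        (fun v hv => ih v (Multiset.mem_cons_of_mem hv))
      obtain ⟨N', hs', hN'⟩ := ih v (Multiset.mem_cons_self v s)
      -- `N` serves the elements treated so far and `N'` the new one; normality lets all of them
      -- move on to the common reduct `Q`.
      obtain ⟨Q, h1, h2⟩ := hs.confluent hs'
      refine ⟨Q, hs.trans h1, fun w hw => ?_⟩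
      rcases Multiset.mem_cons.1 hw with rfl | hw
      · exact hN'.steps h2 (hn w (Multiset.mem_cons_self _ _))
      · exact (hN w hw).steps h1 (hn w (Multiset.mem_cons_of_mem hw))
  | der _ ih =>
    intro hn
    obtain ⟨hb, hn⟩ := Res.isNormal_der.1 hn
    obtain ⟨N, hs, hN⟩ := ih hn
    -- Normality of the dereliction says that its argument is not a bag under a list context. Hence
    -- `N` is not an answer, which restores the side condition that mode `head` had dropped.
    exact ⟨N, hs, fun h => .appDer (hN.bagSpine_iff.not.1 hb) hN h⟩
  | spine _ ih =>
    intro hn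
    obtain ⟨N, hs, hN⟩ := ih hn
    exact ⟨N, hs, fun h => .appSpine hN h⟩
  | app h _ _ ih ih' =>
    intro hn
    obtain ⟨-, h1, h2⟩ := Res.isNormal_app.1 hn
    obtain ⟨N, hs, hN⟩ := ih h1
    obtain ⟨N', hs', hN'⟩ := ih' h2
    exact ⟨_, h.trans (hs.app hs'), hN hN'⟩

end EvApproxV

-- The theorem for dCBV

theorem taylorTreeV_bohmV (M : Term) : taylorTreeV (bohmV M) = nf (taylorV M) := by
  ext p
  simp only [taylorTreeV, Set.mem_iUnion, exists_prop]
  constructor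
  · rintro ⟨A, ⟨hA, N, hN, hle⟩, hp⟩
    have hp : ApproxSpine true p A := approxV_iff.1 hp
    obtain ⟨m, hm, hs⟩ := ApproxSpine.of_stepsV hN (hp.of_le hle)
    exact ⟨(ApproximantV.approx_isNormal A).1 hA hp, m, approxV_iff.2 hm, hs⟩
  · rintro ⟨hn, m, hm, hs⟩
    have hm : EvApproxV .arg m M := .of_approxSpine (approxV_iff.1 hm)
    obtain ⟨N, hN, hp⟩ := (hm.stepsR hs).realized hn
    obtain ⟨A, hA, hle, h⟩ := exists_approximantV N
    exact ⟨A, ⟨hA, N, stepV_eq ▸ hN, hle⟩, approxV_iff.2 (h hp hn)⟩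

/-! ### dCBN resource approximation -/

namespace ApproxN

theorem inv_rename (M : Tm B) : ∀ {m : Res} (f : ℕ → ℕ),
    ApproxN m (M.rename f) → ∃ n, n.rename f = m ∧ ApproxN n M := by
  have bag : ∀ (N : Tm B) (f : ℕ → ℕ) (s : Multiset Res),
      (∀ v ∈ s, ∃ n, n.rename f = v ∧ ApproxN n N) →
      ∃ t : Multiset Res, t.map (Res.rename f) = s ∧ ∀ n ∈ t, ApproxN n N := by
    intro N f s h
    obtain ⟨t, ht, h'⟩ := exists_map_of_forall (f := Res.rename f)
      (P := (ApproxN · N)) fun v hv => (h v hv).imp fun _ h => h.symm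
    exact ⟨t, h', ht⟩
  induction M with
  | bot b => intro m f h; cases h
  | var x => intro m f h; cases h; exact ⟨.var x, by simp, .var x⟩
  | lam M ih =>
    intro m f h
    cases h with
    | lam h =>
      obtain ⟨n, rfl, h'⟩ := ih _ h
      exact ⟨_, Res.rename_lam _ _, .lam h'⟩
  | app M N ih ih' =>
    intro m f h
    cases h with
    | app h1 h2 =>
      obtain ⟨n, rfl, h1'⟩ := ih _ h1
      obtain ⟨t, rfl, h2'⟩ := bag N f _ fun v hv => ih' _ (h2 v hv)
      exact ⟨.app n (.bag t), by simp, .app h1' h2'⟩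
  | es M N ih ih' =>
    intro m f h
    cases h with
    | es h1 h2 =>
      obtain ⟨n, rfl, h1'⟩ := ih _ h1
      obtain ⟨t, rfl, h2'⟩ := bag N f _ fun v hv => ih' _ (h2 v hv)
      exact ⟨.es n (.bag t), by simp, .es h1' h2'⟩

theorem inv_plug (L : List (Tm B)) : ∀ {m : Res} {M : Tm B}, ApproxN m (plug L M) →
    ∃ l n, m = .plug l n ∧ l.length = L.length ∧ ApproxN n M ∧
      ∀ {q : Res} {Q : Tm B}, ApproxN q Q → ApproxN (.plug l q) (plug L Q) := by
  induction L using List.reverseRecOn with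
  | nil => exact fun h => ⟨[], _, rfl, rfl, h, fun h => h⟩
  | append_singleton L N ih =>
    intro m M h
    rw [plug_append] at h
    cases h with
    | @es m s _ _ h1 h2 =>
      obtain ⟨l, q, rfl, hl, hq, hp⟩ := ih h1
      refine ⟨l ++ [.bag s], q, (Res.plug_append _ _ _).symm, by simp [hl], hq, fun h => ?_⟩
      rw [plug_append, Res.plug_append]
      exact .es (hp h) h2

/-- Each substituted occurrence contributes the approximation of `W` found at its place, and the
contributions are summed over the whole term. No restriction to values is needed in dCBN. -/
theorem exists_linSubst (k : ℕ) (M : Tm B) : ∀ {d : ℕ} {W : Tm B} {σ : ℕ → Tm B} {r : Res},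
    InstAt k d W σ → ApproxN r (M.subst σ) →
    ∃ s m, (∀ v ∈ s, ApproxN v W) ∧ ApproxN m M ∧ LinSubst k d s m r := by
  have bag : ∀ {N : Tm B} {d : ℕ} {W : Tm B} {u : Multiset Res},
      (∀ v ∈ u, ∃ s m, (∀ v ∈ s, ApproxN v W) ∧ ApproxN m N ∧ LinSubst k d s m v) →
      ∃ s t, (∀ v ∈ s, ApproxN v W) ∧ (∀ m ∈ t, ApproxN m N) ∧
        LinSubst k d s (.bag t) (.bag u) := by
    intro V d W u h
    induction u using Multiset.induction with
    | empty => exact ⟨0, 0, by simp, by simp, .bagNil d⟩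
    | cons v u ih =>
      obtain ⟨s, m, hs, hm, h1⟩ := h v (Multiset.mem_cons_self v u)
      obtain ⟨s', t, hs', ht, h2⟩ := ih fun v hv => h v (Multiset.mem_cons_of_mem hv)
      refine ⟨s + s', m ::ₘ t, fun v hv => ?_, fun v hv => ?_, .bagCons h1 h2⟩
      · exact (Multiset.mem_add.1 hv).elim (hs v) (hs' v)
      · rcases Multiset.mem_cons.1 hv with rfl | hv
        · exact hm
        · exact ht v hv
  have shift : ∀ {s : Multiset Res} {W : Tm B}, (∀ v ∈ s, ApproxN v (W.rename Nat.succ)) →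
      ∃ t : Multiset Res, (∀ v ∈ t, ApproxN v W) ∧ t.map (Res.rename Nat.succ) = s :=
    fun h => exists_map_of_forall fun v hv =>
      (inv_rename _ _ (h v hv)).imp fun _ h => ⟨h.2, h.1⟩
  induction M with
  | bot b => intro d W σ r hσ h; cases h
  | var x =>
    intro d W σ r hσ h
    change ApproxN r (σ x) at h
    rcases hσ.cases x with ⟨hx, h'⟩ | ⟨rfl, h'⟩ | ⟨y, hy, rfl, h'⟩ <;> rw [h'] at h
    · cases h
      exact ⟨0, _, by simp, .var x, .lt hx⟩
    · refine ⟨{r}, _, fun v hv => ?_, .var x, .hit x r⟩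
      rwa [Multiset.mem_singleton.1 hv]
    · cases h
      exact ⟨0, _, by simp, .var _, .gt hy⟩
  | lam M ih =>
    intro d W σ r hσ h
    cases h with
    | lam h =>
      obtain ⟨s, m, hs, hm, hl⟩ := ih hσ.lift h
      obtain ⟨t, ht, rfl⟩ := shift hs
      exact ⟨t, _, ht, .lam hm, .lam hl⟩
  | app M N ihM ihN =>
    intro d W σ r hσ h
    cases h with
    | app h1 h2 =>
      obtain ⟨s, m, hs, hm, hl⟩ := ihM hσ h1
      obtain ⟨s', t, hs', ht, hl'⟩ := bag fun v hv => ihN hσ (h2 v hv)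
      exact ⟨s + s', _, fun v hv => (Multiset.mem_add.1 hv).elim (hs v) (hs' v),
        .app hm ht, .app hl hl'⟩
  | es M N ihM ihN =>
    intro d W σ r hσ h
    cases h with
    | es h1 h2 =>
      obtain ⟨s, m, hs, hm, hl⟩ := ihM hσ.lift h1
      obtain ⟨u, hu, rfl⟩ := shift hs
      obtain ⟨s', t, hs', ht, hl'⟩ := bag fun v hv => ihN hσ (h2 v hv)
      exact ⟨u + s', _, fun v hv => (Multiset.mem_add.1 hv).elim (hu v) (hs' v),
        .es hm ht, .es hl hl'⟩

/-- Approximations can be pulled back along a reduction step. -/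
theorem of_stepN {M M' : Term} (h : StepN M M') : ∀ {m' : Res},
    ApproxN m' M' → ∃ m, ApproxN m M ∧ StepsR m m' := by
  have bag : ∀ {N N' : Term} {t : Multiset Res},
      (∀ {m' : Res}, ApproxN m' N' → ∃ m, ApproxN m N ∧ StepsR m m') →
      (∀ n ∈ t, ApproxN n N') →
      ∃ s : Multiset Res, (∀ n ∈ s, ApproxN n N) ∧ StepsR (.bag s) (.bag t) := by
    intro N N' t h ht
    obtain ⟨s, hs, hr⟩ := exists_rel_of_forall fun v hv => h (ht v hv)
    exact ⟨s, hs, .bag hr⟩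
  induction h with
  | beta L M N =>
    intro r h
    obtain ⟨l, q, rfl, hl, hq, hp⟩ := inv_plug L h
    cases hq with
    | es h1 h2 =>
      obtain ⟨t, ht, rfl⟩ := exists_map_of_forall (P := (ApproxN · N)) fun v hv =>
        (inv_rename N _ (h2 v hv)).imp fun _ h => ⟨h.2, h.1⟩
      refine ⟨_, .app (hp (.lam h1)) ht, .single ?_⟩
      rw [← hl, ← Res.rename_bag]
      exact .beta l _ _
  | subst M N =>
    intro r h
    obtain ⟨s, m, hs, hm, hlin⟩ := exists_linSubst 0 M (d := 0) (W := N)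
      ⟨fun x hx => by omega, rfl, fun x _ => rfl⟩ h
    exact ⟨_, .es hm hs, .single (.subst [] s m r hlin)⟩
  | lam _ ih =>
    intro r h
    cases h with
    | lam h =>
      obtain ⟨m, hm, hs⟩ := ih h
      exact ⟨_, .lam hm, hs.lam⟩
  | appL N _ ih =>
    intro r h
    cases h with
    | app h1 h2 =>
      obtain ⟨m, hm, hs⟩ := ih h1
      exact ⟨_, .app hm h2, .app hs .refl⟩
  | appR M _ ih =>
    intro r h
    cases h with
    | app h1 h2 =>
      obtain ⟨s, hs, hr⟩ := bag ih h2
      exact ⟨_, .app h1 hs, .app .refl hr⟩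
  | esL N _ ih =>
    intro r h
    cases h with
    | es h1 h2 =>
      obtain ⟨m, hm, hs⟩ := ih h1
      exact ⟨_, .es hm h2, .es hs .refl⟩
  | esR M _ ih =>
    intro r h
    cases h with
    | es h1 h2 =>
      obtain ⟨s, hs, hr⟩ := bag ih h2
      exact ⟨_, .es h1 hs, .es .refl hr⟩

theorem of_stepsN {M M' : Term} (h : Relation.ReflTransGen StepN M M') :
    ∀ {m' : Res}, ApproxN m' M' → ∃ m, ApproxN m M ∧ StepsR m m' := by
  induction h using Relation.ReflTransGen.head_induction_on with
  | refl => exact fun h => ⟨_, h, .refl⟩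
  | head h _ ih =>
    intro m' h'
    obtain ⟨m, hm, hs⟩ := ih h'
    obtain ⟨n, hn, hs'⟩ := of_stepN h hm
    exact ⟨n, hn, hs'.trans hs⟩

theorem of_le {A : PTerm} {M : Term} (h : Le A M) : ∀ {m : Res}, ApproxN m A → ApproxN m M := by
  induction h with
  | bot M => intro m h; cases h
  | var x => intro m h; cases h; exact .var x
  | lam _ ih => intro m h; cases h with | lam h => exact .lam (ih h)
  | app _ _ ih ih' =>
    intro m h
    cases h with | app h1 h2 => exact .app (ih h1) fun n hn => ih' (h2 n hn)
  | es _ _ ih ih' =>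
    intro m h
    cases h with | es h1 h2 => exact .es (ih h1) fun n hn => ih' (h2 n hn)

theorem lamSpine {M N R : Tm B} (hb : Beta M N R) : ∀ {m : Res}, ApproxN m M → m.LamSpine := by
  induction hb with
  | lam => intro m h; cases h; exact Res.lamSpine_lam _
  | es _ _ ih => intro m h; cases h with | es h1 _ => simpa using ih h1

/-- In dCBN the argument of an explicit substitution is approximated by a bag, so every explicit
substitution that is seen at all is a resource redex. This is why dCBN approximants contain none. -/
theorem not_isNormal_es (m : Res) (s : Multiset Res) : ¬ (Res.es m (.bag s)).IsNormal :=
  fun h => (Res.isNormal_es.1 h).1 (Res.bagSpine_bag s)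

/-- Normal approximations are preserved by reduction. -/
theorem step {N N' : Term} (h : Step false N N') : ∀ {p : Res},
    ApproxN p N → p.IsNormal → ApproxN p N' := by
  induction h with
  | beta hb =>
    intro p h hn
    cases h with
    | app h1 _ => exact ((Res.isNormal_app.1 hn).1 (h1.lamSpine hb)).elim
  | sub => intro p h hn; cases h; exact (not_isNormal_es _ _ hn).elim
  | lam _ ih => intro p h hn; cases h with | lam h => exact .lam (ih h (Res.isNormal_lam.1 hn))
  | appL N _ ih =>
    intro p h hn
    cases h with | app h1 h2 => exact .app (ih h1 (Res.isNormal_app.1 hn).2.1) h2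
  | appR M _ ih =>
    intro p h hn
    cases h with
    | app h1 h2 =>
      have := Res.isNormal_bag.1 (Res.isNormal_app.1 hn).2.2
      exact .app h1 fun n hn => ih (h2 n hn) (this n hn)
  | esL => intro p h hn; cases h; exact (not_isNormal_es _ _ hn).elim
  | esR => intro p h hn; cases h; exact (not_isNormal_es _ _ hn).elim

theorem steps {N N' : Term} (h : Steps false N N') {p : Res} (hp : ApproxN p N)
    (hn : p.IsNormal) : ApproxN p N' := by
  induction h with
  | refl => exact hp
  | tail _ h ih => exact ih.step h hn

end ApproxN

/-! ### Approximations of dCBN approximants -/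

theorem NeutralN.not_lamSpine {A : PTerm} (hA : NeutralN A) {m : Res} (h : ApproxN m A) :
    ¬ m.LamSpine := by
  cases hA with
  | var => cases h; exact Res.not_lamSpine_var _
  | app => cases h; exact Res.not_lamSpine_app _ _

theorem ApproximantN.approx_isNormal (A : PTerm) :
    ApproximantN A → ∀ {m : Res}, ApproxN m A → m.IsNormal := by
  induction A with
  | bot => intro _ m h; cases h
  | var x => intro _ m h; cases h; exact Res.isNormal_var x
  | lam A ih =>
    intro hA m h
    cases hA with
    | neutral h => cases h
    | lam hA => cases h with | lam h => exact Res.isNormal_lam.2 (ih hA h)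
  | app A A' ih ih' =>
    intro hA m h
    cases hA with
    | neutral hA =>
      cases hA with
      | app hA hA' =>
        cases h with
        | app h1 h2 =>
          exact Res.isNormal_app.2 ⟨hA.not_lamSpine h1, ih (.neutral hA) h1,
            Res.isNormal_bag.2 fun n hn => ih' hA' (h2 n hn)⟩
  | es A A' =>
    intro hA
    cases hA with
    | neutral hA => cases hA

/-- The approximation excludes `⊥`, and the hypothesis on `m` excludes abstractions. -/
theorem ApproximantN.neutralN {A : PTerm} (hA : ApproximantN A) {m : Res} (h : ApproxN m A)
    (hm : ¬ m.LamSpine) : NeutralN A := by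
  cases hA with
  | bot => cases h
  | neutral hA => exact hA
  | lam => cases h; exact (hm (Res.lamSpine_lam _)).elim

/-- The largest dCBN approximant of a term has all its normal approximations. -/
theorem exists_approximantN (N : Term) : ∃ A : PTerm, ApproximantN A ∧ Le A N ∧
    ∀ {p : Res}, ApproxN p N → p.IsNormal → ApproxN p A := by
  induction N with
  | bot b => exact b.elim
  | var x =>
    refine ⟨.var x, .neutral (.var x), .var x, fun h _ => ?_⟩
    cases h
    exact .var x
  | lam N ih =>
    obtain ⟨A, hA, hle, h⟩ := ih
    refine ⟨.lam A, .lam hA, .lam hle, fun hp hn => ?_⟩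
    cases hp with
    | lam hp => exact .lam (h hp (Res.isNormal_lam.1 hn))
  | app M N ihM ihN =>
    obtain ⟨A, hA, hle, h⟩ := ihM
    obtain ⟨A', hA', hle', h'⟩ := ihN
    -- As in dCBV, one normal approximation forces the function part to be neutral; otherwise there
    -- is none to preserve and `⊥` will do.
    have key : ∀ {p : Res}, ApproxN p (.app M N) → p.IsNormal →
        NeutralN A ∧ ApproxN p (.app A A') := by
      intro p hp hn
      cases hp with
      | app h1 h2 =>
        obtain ⟨hl, hm, hn⟩ := Res.isNormal_app.1 hn
        exact ⟨hA.neutralN (h h1 hm) hl,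
          .app (h h1 hm) fun n hs => h' (h2 n hs) (Res.isNormal_bag.1 hn n hs)⟩
    by_cases hL : NeutralN A
    · exact ⟨.app A A', .neutral (.app hL hA'), .app hle hle', fun hp hn => (key hp hn).2⟩
    · exact ⟨PTerm.bottom, .bot, .bot _, fun hp hn => (hL (key hp hn).1).elim⟩
  | es M N =>
    refine ⟨PTerm.bottom, .bot, .bot _, fun hp hn => ?_⟩
    cases hp
    exact (ApproxN.not_isNormal_es _ _ hn).elim

/-! ### Approximation up to reduction in dCBN -/

/-- dCBN resource approximation where the approximated term may be reduced at every node, in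
different ways for the different elements of a bag. If `b` does not hold, then `EvApproxN b m M`
means that `m` is a bag of approximations of `M`. -/
inductive EvApproxN : Bool → Res → Term → Prop
  | var {M : Term} {x : ℕ} : Steps false M (.var x) → EvApproxN true (.var x) M
  | lam {M M' : Term} {m : Res} : Steps false M (.lam M') → EvApproxN true m M' →
      EvApproxN true (.lam m) M
  | app {M M' N : Term} {m n : Res} : Steps false M (.app M' N) → EvApproxN true m M' →
      EvApproxN false n N → EvApproxN true (.app m n) M
  | es {M M' N : Term} {m n : Res} : Steps false M (.es M' N) → EvApproxN true m M' →
      EvApproxN false n N → EvApproxN true (.es m n) M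
  | bag {M : Term} {s : Multiset Res} : (∀ v ∈ s, EvApproxN true v M) →
      EvApproxN false (.bag s) M

namespace EvApproxN

theorem of_steps {m : Res} {M M' : Term} (hs : Steps false M M') (h : EvApproxN true m M') :
    EvApproxN true m M := by
  cases h with
  | var h => exact .var (hs.trans h)
  | lam h h1 => exact .lam (hs.trans h) h1
  | app h h1 h2 => exact .app (hs.trans h) h1 h2
  | es h h1 h2 => exact .es (hs.trans h) h1 h2

theorem rename {b : Bool} {m : Res} {M : Term} (h : EvApproxN b m M) :
    ∀ f : ℕ → ℕ, EvApproxN b (m.rename f) (M.rename f) := by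
  induction h with
  | var h => intro f; rw [Res.rename_var]; exact .var (h.rename f)
  | lam h _ ih => intro f; rw [Res.rename_lam]; exact .lam (h.rename f) (ih _)
  | app h _ _ ih ih' => intro f; rw [Res.rename_app]; exact .app (h.rename f) (ih f) (ih' f)
  | es h _ _ ih ih' => intro f; rw [Res.rename_es]; exact .es (h.rename f) (ih _) (ih' _)
  | bag _ ih =>
    intro f
    rw [Res.rename_bag]
    refine .bag fun v hv => ?_
    obtain ⟨m, hm, rfl⟩ := Multiset.mem_map.1 hv
    exact ih m hm f

theorem of_approxN {m : Res} {M : Term} (h : ApproxN m M) : EvApproxN true m M := by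
  induction h with
  | var x => exact .var .refl
  | lam _ ih => exact .lam .refl ih
  | app _ _ ih ih' => exact .app .refl ih (.bag ih')
  | es _ _ ih ih' => exact .es .refl ih (.bag ih')

theorem inv_var {b : Bool} {x : ℕ} {M : Term} (h : EvApproxN b (.var x) M) :
    b = true ∧ Steps false M (.var x) := by
  generalize e : Res.var x = q at h
  replace e := congrArg Res.view e
  cases h <;> simp at e
  case var h => exact ⟨rfl, e ▸ h⟩

theorem inv_lam {b : Bool} {m : Res} {M : Term} (h : EvApproxN b (.lam m) M) :
    b = true ∧ ∃ M', Steps false M (.lam M') ∧ EvApproxN true m M' := by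
  generalize e : Res.lam m = q at h
  replace e := congrArg Res.view e
  cases h <;> simp at e
  case lam h1 h => exact ⟨rfl, _, h, e ▸ h1⟩

theorem inv_app {b : Bool} {m n : Res} {M : Term} (h : EvApproxN b (.app m n) M) :
    b = true ∧ ∃ M' N, Steps false M (.app M' N) ∧ EvApproxN true m M' ∧ EvApproxN false n N := by
  generalize e : Res.app m n = q at h
  replace e := congrArg Res.view e
  cases h <;> simp at e
  case app h1 h2 h => exact ⟨rfl, _, _, h, e.1 ▸ h1, e.2 ▸ h2⟩

theorem inv_es {b : Bool} {m n : Res} {M : Term} (h : EvApproxN b (.es m n) M) :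
    b = true ∧ ∃ M' N, Steps false M (.es M' N) ∧ EvApproxN true m M' ∧ EvApproxN false n N := by
  generalize e : Res.es m n = q at h
  replace e := congrArg Res.view e
  cases h <;> simp at e
  case es h1 h2 h => exact ⟨rfl, _, _, h, e.1 ▸ h1, e.2 ▸ h2⟩

theorem inv_bag {b : Bool} {s : Multiset Res} {M : Term} (h : EvApproxN b (.bag s) M) :
    b = false ∧ ∀ v ∈ s, EvApproxN true v M := by
  generalize e : Res.bag s = q at h
  replace e := congrArg Res.view e
  cases h <;> simp at e
  case bag h => exact ⟨rfl, e ▸ h⟩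

theorem not_der {b : Bool} {m : Res} {M : Term} : ¬ EvApproxN b (.der m) M := by
  intro h
  generalize e : Res.der m = q at h
  replace e := congrArg Res.view e
  cases h <;> simp at e

theorem inv_plug (l : List Res) : ∀ {m : Res} {M : Term},
    EvApproxN true (.plug l m) M → ∃ L M', L.length = l.length ∧ Steps false M (plug L M') ∧
      EvApproxN true m M' ∧ ∀ {q : Res} {Q : Term},
        EvApproxN true q Q → EvApproxN true (.plug l q) (plug L Q) := by
  induction l using List.reverseRecOn with
  | nil => exact fun h => ⟨[], _, rfl, .refl, h, fun h => h⟩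
  | append_singleton l n ih =>
    intro m M h
    rw [Res.plug_append] at h
    obtain ⟨-, M', N, hs, h1, h2⟩ := h.inv_es
    obtain ⟨L, Q, hL, hs', hq, hp⟩ := ih h1
    refine ⟨L ++ [N], Q, by simp [hL], ?_, hq, fun {q Q} h => ?_⟩
    · rw [plug_append]
      exact hs.trans (hs'.es .refl)
    · rw [plug_append, Res.plug_append]
      exact .es .refl (hp h) h2

/-- As in dCBV, but dCBN reductions are preserved by arbitrary substitutions, so `W` need not be a
value. -/
theorem linSubst {k d : ℕ} {s : Multiset Res} {m r : Res} (h : LinSubst k d s m r) :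
    ∀ {b : Bool} {M W : Term} {σ : ℕ → Term}, InstAt k d W σ →
      (∀ v ∈ s, EvApproxN true v W) → EvApproxN b m M → EvApproxN b r (M.subst σ) := by
  have shift : ∀ {s : Multiset Res} {W : Term}, (∀ v ∈ s, EvApproxN true v W) →
      ∀ v ∈ s.map (Res.rename Nat.succ), EvApproxN true v (W.rename Nat.succ) := by
    intro s W h v hv
    obtain ⟨w, hw, rfl⟩ := Multiset.mem_map.1 hv
    exact (h w hw).rename _
  have sub : ∀ {M N : Term} (σ : ℕ → Term), Steps false M N →
      Steps false (M.subst σ) (N.subst σ) := fun σ h => h.subst (by simp)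
  induction h with
  | hit d n =>
    intro b M W σ hσ hs h
    obtain ⟨rfl, h'⟩ := h.inv_var
    refine of_steps (sub σ h') ?_
    change EvApproxN true n (σ d)
    rw [hσ.2.1]
    exact hs n (Multiset.mem_singleton_self n)
  | @lt d x hx =>
    intro b M W σ hσ hs h
    obtain ⟨rfl, h'⟩ := h.inv_var
    have := sub σ h'
    rw [Tm.subst, hσ.1 x hx] at this
    exact .var this
  | @gt d x hx =>
    intro b M W σ hσ hs h
    obtain ⟨rfl, h'⟩ := h.inv_var
    have := sub σ h'
    rw [Tm.subst, hσ.2.2 x hx] at this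
    exact .var this
  | lam _ ih =>
    intro b M W σ hσ hs h
    obtain ⟨rfl, M', h, h1⟩ := h.inv_lam
    exact .lam (sub σ h) (ih hσ.lift (shift hs) h1)
  | app _ _ ih ih' =>
    intro b M W σ hσ hs h
    obtain ⟨rfl, M', N, h, h1, h2⟩ := h.inv_app
    exact .app (sub σ h) (ih hσ (fun v hv => hs v (Multiset.mem_add.2 (.inl hv))) h1)
      (ih' hσ (fun v hv => hs v (Multiset.mem_add.2 (.inr hv))) h2)
  | es _ _ ih ih' =>
    intro b M W σ hσ hs h
    obtain ⟨rfl, M', N, h, h1, h2⟩ := h.inv_es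
    exact .es (sub σ h)
      (ih hσ.lift (shift fun v hv => hs v (Multiset.mem_add.2 (.inl hv))) h1)
      (ih' hσ (fun v hv => hs v (Multiset.mem_add.2 (.inr hv))) h2)
  | der => intro b M W σ _ _ h; exact (not_der h).elim
  | bagNil d =>
    intro b M W σ hσ hs h
    obtain ⟨rfl, -⟩ := h.inv_bag
    exact .bag (by simp)
  | bagCons _ _ ih ih' =>
    intro b M W σ hσ hs h
    obtain ⟨rfl, h'⟩ := h.inv_bag
    refine .bag fun v hv => ?_
    rcases Multiset.mem_cons.1 hv with rfl | hv
    · exact ih hσ (fun v hv => hs v (Multiset.mem_add.2 (.inl hv)))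
        (h' _ (Multiset.mem_cons_self _ _))
    · exact (ih' hσ (fun v hv => hs v (Multiset.mem_add.2 (.inr hv)))
        (.bag fun v hv => h' v (Multiset.mem_cons_of_mem hv))).inv_bag.2 v hv

theorem stepR {m : Res} {o : Option Res} (h : StepR m o) : ∀ {m' : Res}, o = some m' →
    ∀ {b : Bool} {M : Term}, EvApproxN b m M → EvApproxN b m' M := by
  induction h with
  | beta l m n =>
    rintro _ ⟨⟩ b M h
    obtain ⟨rfl, M', N, hs, h1, h2⟩ := h.inv_app
    obtain ⟨L, P, hL, hs', h3, hp⟩ := inv_plug l h1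
    obtain ⟨-, P', hs'', h3⟩ := h3.inv_lam
    have : Steps false M' (plug L P'.lam) := hs'.trans (hs''.plug L)
    refine of_steps ((hs.trans (this.app .refl)).tail (.beta (beta_plug L P' N)))
      (hp (.es .refl h3 ?_))
    rw [hL]
    exact h2.rename _
  | subst l s m r hl =>
    rintro _ ⟨⟩ b M h
    obtain ⟨rfl, M', N, hs, h1, h2⟩ := h.inv_es
    -- Arguments in dCBN are plain bags, so the list context around the bag is empty and the step is
    -- matched by an ordinary dCBN substitution.
    rcases List.eq_nil_or_concat l with rfl | ⟨l, n, rfl⟩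
    · have h4 : EvApproxN true r (Tm.inst 0 N M') :=
        linSubst hl (d := 0) (W := N) ⟨fun x hx => by omega, rfl, fun x _ => rfl⟩ h2.inv_bag.2 h1
      exact of_steps (hs.tail (.sub (.inst M' (by simp)))) h4
    · rw [List.concat_eq_append, Res.plug_append] at h2
      cases h2.inv_es.1
  | substEmpty => rintro _ ⟨⟩
  | derBag => rintro _ ⟨⟩ b M h; exact (not_der h).elim
  | derEmpty => rintro _ ⟨⟩
  | lam _ ih =>
    intro m' e b M h
    obtain ⟨n, rfl, rfl⟩ := Option.map_eq_some_iff.1 e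
    obtain ⟨rfl, M', hs, h1⟩ := h.inv_lam
    exact .lam hs (ih rfl h1)
  | appL _ _ ih =>
    intro m' e b M h
    obtain ⟨n, rfl, rfl⟩ := Option.map_eq_some_iff.1 e
    obtain ⟨rfl, M', N, hs, h1, h2⟩ := h.inv_app
    exact .app hs (ih rfl h1) h2
  | appR _ _ ih =>
    intro m' e b M h
    obtain ⟨n, rfl, rfl⟩ := Option.map_eq_some_iff.1 e
    obtain ⟨rfl, M', N, hs, h1, h2⟩ := h.inv_app
    exact .app hs h1 (ih rfl h2)
  | esL _ _ ih =>
    intro m' e b M h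
    obtain ⟨n, rfl, rfl⟩ := Option.map_eq_some_iff.1 e
    obtain ⟨rfl, M', N, hs, h1, h2⟩ := h.inv_es
    exact .es hs (ih rfl h1) h2
  | esR _ _ ih =>
    intro m' e b M h
    obtain ⟨n, rfl, rfl⟩ := Option.map_eq_some_iff.1 e
    obtain ⟨rfl, M', N, hs, h1, h2⟩ := h.inv_es
    exact .es hs h1 (ih rfl h2)
  | der => intro m' _ b M h; exact (not_der h).elim
  | bag s _ ih =>
    intro m' e b M h
    obtain ⟨n, rfl, rfl⟩ := Option.map_eq_some_iff.1 e
    obtain ⟨rfl, h'⟩ := h.inv_bag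
    refine .bag fun v hv => ?_
    rcases Multiset.mem_cons.1 hv with rfl | hv
    · exact ih rfl (h' _ (Multiset.mem_cons_self _ _))
    · exact h' v (Multiset.mem_cons_of_mem hv)

theorem stepsR {m m' : Res} (h : StepsR m m') {b : Bool} {M : Term} (hm : EvApproxN b m M) :
    EvApproxN b m' M := by
  induction h with
  | refl => exact hm
  | tail _ h ih => exact stepR h rfl ih

/-- As in dCBV, the reductions chosen by the elements of a bag are joined by confluence, and their
normal approximations persist along the joining reductions. -/
theorem realized {b : Bool} {p : Res} {M : Term} (h : EvApproxN b p M) :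
    p.IsNormal → ∃ N, Steps false M N ∧
      if b then ApproxN p N else ∃ s, p = .bag s ∧ ∀ v ∈ s, ApproxN v N := by
  induction h with
  | @var _ x h => exact fun _ => ⟨_, h, ApproxN.var x⟩
  | lam h _ ih =>
    intro hn
    obtain ⟨N, hs, hN⟩ := ih (Res.isNormal_lam.1 hn)
    exact ⟨_, h.trans hs.lam, ApproxN.lam hN⟩
  | app h _ _ ih ih' =>
    intro hn
    obtain ⟨-, h1, h2⟩ := Res.isNormal_app.1 hn
    obtain ⟨N, hs, hN⟩ := ih h1
    obtain ⟨N', hs', s, rfl, hN'⟩ := ih' h2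
    exact ⟨_, h.trans (hs.app hs'), ApproxN.app hN hN'⟩
  | es h _ _ ih ih' =>
    intro hn
    obtain ⟨-, h1, h2⟩ := Res.isNormal_es.1 hn
    obtain ⟨N, hs, hN⟩ := ih h1
    obtain ⟨N', hs', s, rfl, hN'⟩ := ih' h2
    exact ⟨_, h.trans (hs.es hs'), ApproxN.es hN hN'⟩
  | @bag M s h ih =>
    intro hn
    clear h
    replace hn := Res.isNormal_bag.1 hn
    suffices ∃ N, Steps false M N ∧ ∀ v ∈ s, ApproxN v N from
      this.imp fun N h => ⟨h.1, s, rfl, h.2⟩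
    replace ih : ∀ v ∈ s, ∃ N, Steps false M N ∧ ApproxN v N :=
      fun v hv => ih v hv (hn v hv)
    induction s using Multiset.induction with
    | empty => exact ⟨M, .refl, by simp⟩
    | cons v s ihs =>
      obtain ⟨N, hs, hN⟩ := ihs (fun v hv => hn v (Multiset.mem_cons_of_mem hv))
        (fun v hv => ih v (Multiset.mem_cons_of_mem hv))
      obtain ⟨N', hs', hN'⟩ := ih v (Multiset.mem_cons_self v s)
      obtain ⟨Q, h1, h2⟩ := hs.confluent hs'
      refine ⟨Q, hs.trans h1, fun w hw => ?_⟩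
      rcases Multiset.mem_cons.1 hw with rfl | hw
      · exact hN'.steps h2 (hn w (Multiset.mem_cons_self _ _))
      · exact (hN w hw).steps h1 (hn w (Multiset.mem_cons_of_mem hw))

end EvApproxN

-- The theorem for dCBN

theorem taylorTreeN_bohmN (M : Term) : taylorTreeN (bohmN M) = nf (taylorN M) := by
  ext p
  simp only [taylorTreeN, Set.mem_iUnion, exists_prop]
  constructor
  · rintro ⟨A, ⟨hA, N, hN, hle⟩, hp⟩
    have hp : ApproxN p A := hp
    obtain ⟨m, hm, hs⟩ := ApproxN.of_stepsN hN (hp.of_le hle)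
    exact ⟨ApproximantN.approx_isNormal A hA hp, m, hm, hs⟩
  · rintro ⟨hn, m, hm, hs⟩
    have hm : EvApproxN true m M := .of_approxN hm
    obtain ⟨N, hN, hp⟩ := (hm.stepsR hs).realized hn
    obtain ⟨A, hA, hle, h⟩ := exists_approximantN N
    exact ⟨A, ⟨hA, N, stepN_eq ▸ hN, hle⟩, h hp hn⟩

end DistantCalc

theorem mainTheorem4 :
    (∀ M : DistantCalc.Term,
      DistantCalc.taylorTreeV (DistantCalc.bohmV M) = DistantCalc.nf (DistantCalc.taylorV M)) ∧
    (∀ M : DistantCalc.Term,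
      DistantCalc.taylorTreeN (DistantCalc.bohmN M) = DistantCalc.nf (DistantCalc.taylorN M)) :=
  ⟨DistantCalc.taylorTreeV_bohmV, DistantCalc.taylorTreeN_bohmN⟩
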